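/- A *concurrent game* is played by two players on a finite arena $\langle A,V,\lambda,\delta\rangle$: in a vertex $v$ the players simultaneously choose actions $a_1\in\lambda(v,1)\neq\emptyset$ and $a_2\in\lambda(v,2)\neq\emptyset$, and the token moves to $\delta(v,a_1,a_2)$. A (pure) strategy maps histories in $(V\times A\times A)^*\cdot V$ to allowed actions. Player $i$ *controls* $v$ if his allowed action alone determines the next vertex; the game is *turn-based* if every vertex is controlled by some player. A *qualitative objective* $\alpha$ equips a game with a description $d$ (for instance a number of priorities, or a list of sets of colours), written as a list of natural numbers in unary, and with a colouring of the vertices by a finite set of colours determined by $d$; whether Player 1 wins an infinite play depends, for given $d$, only on the set of colours that the play visits and on the set of colours that it visits infinitely often. This includes reachability, Büchi, parity and Müller objectives (the latter given by a colouring of the vertices and a list of sets of colours). A *discrete bidding game with transducer-based tie-breaking* consists of a finite directed graph $(V,E)$ in which every vertex has a successor, a total budget $N\in\mathbb N$, and a finite deterministic transducer with states $Q$, transition function $\Delta: Q\times (V\times\{1,2\}\times\{\bot,\top\}\times\{0,\dots,N\})\to Q$ and labelling $\Gamma:Q\to\{1,2\}$. In a configuration $\langle v,B_1,B_2,s\rangle$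 with $B_1+B_2=N$ the players simultaneously submit bids $b_i\in\{0,\dots,B_i\}$. The higher bidder wins, and in case of a tie Player $\Gamma(s)$ wins. Knowing the bids, the winner $i$ moves the token to some $v'$ with $(v,v')\in E$ and pays $b_i$ to the other player, and the transducer moves to $\Delta(s,\langle v',i,t,b_i\rangle)$, where $t$ tells whether a tie occurred. The transducer is *un-aware of ties* if $\Delta$ does not depend on $t$. The objective refers to the sequence of vertices visited by the token. For a qualitative objective $\alpha$, let $\text{TB-WIN}_\alpha$ be the problem: given a turn-based game with objective $\alpha$ (by explicit tables) and a vertex $v$, decide whether Player 1 has a winning strategy from $v$. Let $\text{BID-WIN}_{\alpha,\text{trans}}$ be the problem: given a bidding game with transducer-based tie-breaking and objective $\alpha$ (by explicit tables, budgets in unary) and a configuration $c$, decide whether Player 1 has a winning strategy from $c$. **Theorem.** For every qualitative objective $\alpha$, the complexities of $\text{TB-WIN}_\alpha$ and $\text{BID-WIN}_{\alpha,\text{trans}}$ coincide: each of the two problems is polynomial-time many-one reducible to the other. The same holds when $\text{BID-WIN}_{\alpha,\text{trans}}$ is restricted to games whose transducer is un-aware of ties. -/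

import Mathlib

namespace BiddingGames

/-! ### Concurrent games and turn-based games -/

/-- The two players. -/
inductive Player
  | one
  | two
  deriving DecidableEq

/-- The other player. -/
def Player.other : Player → Player
  | .one => .two
  | .two => .one

/-- An arena of a concurrent game with actions `A` and vertices `V`: the (nonempty) sets of allowed
actions of both players at every vertex, and the transition function, which receives the action of
Player 1 first and the action of Player 2 second. -/
structure ConcurrentArena (A V : Type) where
  allowed : V → Player → Set A
  allowed_nonempty : ∀ v i, (allowed v i).Nonempty
  next : V → A → A → V

namespace ConcurrentArena

variable {A V : Type} (G : ConcurrentArena A V)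

/-- The transition from `v` when Player `i` plays `a` and the other player plays `b`. -/
def nextFor (v : V) : Player → A → A → V
  | .one, a, b => G.next v a b
  | .two, a, b => G.next v b a

/-- Player `i` controls `v`: his allowed actions uniquely determine the next vertex, whatever
allowed action the other player chooses. -/
def Controls (i : Player) (v : V) : Prop :=
  ∀ a ∈ G.allowed v i, ∃ u, ∀ b ∈ G.allowed v i.other, G.nextFor v i a b = u

/-- A turn-based game: every vertex is controlled by one of the players. -/
def IsTurnBased : Prop := ∀ v, ∃ i, G.Controls i v

/-- A strategy maps a history in `(V × A × A)* · V` to an action. -/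
abbrev Strategy (A V : Type) := List (V × A × A) → V → A

/-- Legal strategies choose allowed actions only. -/
def IsLegal (i : Player) (σ : Strategy A V) : Prop := ∀ h v, σ h v ∈ G.allowed v i

/-- The history after `n` rounds of the play from `v₀` under two strategies: the past triples
(vertex, action of Player 1, action of Player 2) and the current vertex. -/
def history (σ₁ σ₂ : Strategy A V) (v₀ : V) : ℕ → List (V × A × A) × V
  | 0 => ([], v₀)
  | n + 1 =>
    let p := history σ₁ σ₂ v₀ n
    let a := σ₁ p.1 p.2
    let b := σ₂ p.1 p.2
    (p.1 ++ [(p.2, a, b)], G.next p.2 a b)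

/-- The infinite path of vertices of the play from `v₀` under two strategies. -/
def path (σ₁ σ₂ : Strategy A V) (v₀ : V) (n : ℕ) : V := (G.history σ₁ σ₂ v₀ n).2

/-- Player 1 has a winning strategy from `v` for the objective `Obj`. -/
def PlayerOneWins (Obj : Set (ℕ → V)) (v : V) : Prop :=
  ∃ σ₁, G.IsLegal .one σ₁ ∧ ∀ σ₂, G.IsLegal .two σ₂ → G.path σ₁ σ₂ v ∈ Obj

end ConcurrentArena

/-! ### Qualitative objectives -/

/-- A (type of) qualitative objective. A game with this objective is equipped with a datum
`d : Data` and a colouring of its vertices with `numColours d` colours; whether Player 1 wins a play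
depends on the set of colours that it visits and on the set of colours that it visits infinitely
often. The datum is given to an algorithm as a list of natural numbers, written in unary. -/
structure QualitativeObjective where
  Data : Type
  numColours : Data → ℕ
  code : Data → List ℕ
  code_injective : Function.Injective code
  Wins : (d : Data) → (visited infinitelyOften : Set (Fin (numColours d))) → Prop

/-- The paths on which Player 1 wins, in a game with vertices `V` that is equipped with the datum `d`
and the colouring `col`. -/
def QualitativeObjective.winningPaths (α : QualitativeObjective) {V : Type} (d : α.Data)
    (col : V → Fin (α.numColours d)) : Set (ℕ → V) :=
  {π | α.Wins d {c | ∃ n, col (π n) = c} {c | ∃ᶠ n in Filter.atTop, col (π n) = c}}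

/-! ### Codes of tables -/

/-- The table of a function on `Fin n` whose values are given by lists, written entry by entry. -/
def table {X : Type} {n : ℕ} (f : Fin n → List X) : List X := (List.ofFn f).flatten

theorem table_append_inj {X : Type} {n L : ℕ} {f g : Fin n → List X} {r s : List X}
    (hf : ∀ i, (f i).length = L) (hg : ∀ i, (g i).length = L)
    (h : table f ++ r = table g ++ s) : f = g ∧ r = s := by
  induction n with
  | zero => exact ⟨funext fun i => i.elim0, by simpa [table] using h⟩
  | succ n ih =>
    simp only [table, List.ofFn_succ, List.flatten_cons, List.append_assoc] at h
    obtain ⟨h0, h1⟩ := List.append_inj h (by rw [hf, hg])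
    obtain ⟨h2, h3⟩ := ih (f := fun i => f i.succ) (g := fun i => g i.succ)
      (fun i => hf _) (fun i => hg _) h1
    exact ⟨funext fun i => Fin.cases h0 (fun j => congrFun h2 j) i, h3⟩

theorem table_length {X : Type} {n L : ℕ} {f : Fin n → List X}
    (hf : ∀ i, (f i).length = L) : (table f).length = n * L := by
  induction n with
  | zero => simp [table]
  | succ n ih =>
    have := ih (f := fun i => f i.succ) (fun i => hf _)
    simp only [table, List.ofFn_succ, List.flatten_cons, List.length_append] at this ⊢
    rw [hf, this]; ring

theorem table_inj {X : Type} {n L : ℕ} {f g : Fin n → List X}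
    (hf : ∀ i, (f i).length = L) (hg : ∀ i, (g i).length = L)
    (h : table f = table g) : f = g :=
  (table_append_inj (r := []) (s := []) hf hg (by simpa using h)).1

open Classical in
/-- The code of a truth value. -/
noncomputable def bit (p : Prop) : ℕ := if p then 1 else 0

theorem bit_inj {p q : Prop} (h : bit p = bit q) : p ↔ q := by
  unfold bit at h
  split_ifs at h <;> simp_all

/-- A list of natural numbers as a bit string: each number is written in unary and terminated by the
bit `false`. -/
def unary (l : List ℕ) : List Bool := l.flatMap fun k => List.replicate k true ++ [false]

theorem unary_injective : Function.Injective unary := by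
  intro l
  induction l with
  | nil =>
    intro l' h
    cases l' with
    | nil => rfl
    | cons b l' => simp [unary] at h
  | cons a l ih =>
    intro l' h
    cases l' with
    | nil => simp [unary] at h
    | cons b l' =>
      have key : ∀ (a b : ℕ) (x y : List Bool),
          List.replicate a true ++ false :: x = List.replicate b true ++ false :: y →
            a = b ∧ x = y := by
        intro a
        induction a with
        | zero => intro b x y h; cases b <;> simp_all [List.replicate_succ]
        | succ a iha =>
          intro b x y h
          cases b with
          | zero => simp [List.replicate_succ] at h
          | succ b =>
            simp only [List.replicate_succ, List.cons_append, List.cons.injEq, true_and] at h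
            obtain ⟨h1, h2⟩ := iha b x y h
            exact ⟨by rw [h1], h2⟩
      simp only [unary, List.flatMap_cons, List.append_assoc, List.singleton_append] at h
      obtain ⟨h1, h2⟩ := key _ _ _ _ h
      rw [h1, ih h2]

/-! ### The standard qualitative objectives -/

/-- Reachability: the game is equipped with a target set, the vertices of colour `1`, and Player 1
wins a play iff it visits the target. -/
def reachability : QualitativeObjective where
  Data := Unit
  numColours _ := 2
  code _ := []
  code_injective _ _ _ := rfl
  Wins _ visited _ := 1 ∈ visited

/-- Büchi: the game is equipped with a set of accepting vertices, those of colour `1`, and Player 1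
wins a play iff it visits accepting vertices infinitely often. -/
def buchi : QualitativeObjective where
  Data := Unit
  numColours _ := 2
  code _ := []
  code_injective _ _ _ := rfl
  Wins _ _ inf := 1 ∈ inf

/-- Parity: the game is equipped with priorities `1, …, d` (a vertex of colour `c : Fin d` has
priority `c + 1`), and Player 1 wins a play iff the maximal priority that occurs infinitely often is
odd. -/
def parity : QualitativeObjective where
  Data := ℕ
  numColours d := d
  code d := [d]
  code_injective _ _ h := by simpa using h
  Wins _ _ inf := ∃ c ∈ inf, (∀ c' ∈ inf, c' ≤ c) ∧ Odd ((c : ℕ) + 1)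

/-- Müller: the game is equipped with a colouring of the vertices and a list of sets of colours, and
Player 1 wins a play iff the set of colours that occur infinitely often is in the list. (With the
identity as colouring this is an arbitrary family of sets of vertices.) -/
noncomputable def muller : QualitativeObjective where
  Data := Σ k : ℕ, List (Set (Fin k))
  numColours d := d.1
  code d := d.1 :: d.2.length :: d.2.flatMap fun S => List.ofFn fun c => bit (c ∈ S)
  code_injective := by
    rintro ⟨k, F⟩ ⟨k', F'⟩ h
    simp only [List.cons.injEq] at h
    obtain ⟨rfl, h1, h2⟩ := h
    congr 1
    induction F generalizing F' with
    | nil => exact (List.length_eq_zero_iff.mp h1.symm).symm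
    | cons S F ih =>
      cases F' with
      | nil => simp at h1
      | cons S' F' =>
        simp only [List.flatMap_cons] at h2
        obtain ⟨h3, h4⟩ := List.append_inj h2 (by simp)
        have h5 := List.ofFn_injective h3
        rw [ih F' (by simpa using h1) h4, show S = S' from
          Set.ext fun c => bit_inj (congrFun h5 c)]
  Wins d _ inf := inf ∈ d.2

/-! ### Bidding games with transducer-based tie-breaking -/

/-- A tie-breaking transducer with input alphabet `S` and states `Q`; in a state `s` the winner of
ties is `label s`. -/
structure Transducer (S Q : Type) where
  init : Q
  step : Q → S → Q
  label : Q → Player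

/-- The letters that a tie-breaking transducer reads in a game with vertices `V` and total budget
`N`: the vertex to which the winner of the bidding moves the token, the winner, whether a tie
occurred, and the winning bid. -/
abbrev Letter (V : Type) (N : ℕ) := V × Player × Bool × Fin (N + 1)

/-- An arena of a bidding game with vertices `V`, total budget `N` and tie-breaking by a transducer
with states `Q`. Every vertex has a successor. -/
structure BiddingArena (V Q : Type) (N : ℕ) where
  edge : V → Set V
  edge_nonempty : ∀ v, (edge v).Nonempty
  transducer : Transducer (Letter V N) Q

/-- A configuration `⟨v, B₁, B₂, s⟩`: the position of the token, the budgets, and the state of the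
tie-breaking transducer. The budget of Player 2 is `B₂ = N - B₁`. -/
structure Config (V Q : Type) (N : ℕ) where
  vertex : V
  budgetOne : Fin (N + 1)
  state : Q

/-- The budget of a player in a configuration. -/
def Config.budget {V Q : Type} {N : ℕ} (c : Config V Q N) : Player → ℕ
  | .one => c.budgetOne
  | .two => N - c.budgetOne

/-- The vertices of the concurrent game: configurations `c` and intermediate vertices
`⟨c, b₁, b₂⟩`, which are reached when the bids in `c` are `b₁` and `b₂`. -/
inductive Position (V Q : Type) (N : ℕ)
  | config (c : Config V Q N)
  | inter (c : Config V Q N) (b₁ b₂ : Fin (N + 1))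

/-- The location of the token. -/
def Position.token {V Q : Type} {N : ℕ} : Position V Q N → V
  | .config c => c.vertex
  | .inter c _ _ => c.vertex

/-- The actions of the concurrent game: bids, and choices of the next location of the token. -/
inductive Action (V : Type) (N : ℕ)
  | bid (b : Fin (N + 1))
  | move (v : V)

namespace BiddingArena

variable {V Q : Type} {N : ℕ} (G : BiddingArena V Q N)

/-- The winner of the bidding `(b₁, b₂)` in `c`: the higher bidder, and in case of a tie the player
that the transducer names. -/
def winner (c : Config V Q N) (b₁ b₂ : Fin (N + 1)) : Player :=
  if b₂ < b₁ then .one else if b₁ < b₂ then .two else G.transducer.label c.state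

/-- The configuration after the bidding `(b₁, b₂)` in `c` if the winner moves the token to `v`: the
winner pays his bid to the other player, and the transducer reads the outcome. (The minimum with `N`
has no effect for bids within the budgets.) -/
def outcome (c : Config V Q N) (b₁ b₂ : Fin (N + 1)) (v : V) : Config V Q N :=
  match G.winner c b₁ b₂ with
  | .one =>
    { vertex := v
      budgetOne := ⟨c.budgetOne - b₁, by omega⟩
      state := G.transducer.step c.state (v, .one, decide (b₁ = b₂), b₁) }
  | .two =>
    { vertex := v
      budgetOne := ⟨min (c.budgetOne + b₂) N, by omega⟩
      state := G.transducer.step c.state (v, .two, decide (b₁ = b₂), b₂) }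

/-- The concurrent game of a bidding game. In a configuration both players simultaneously choose bids
within their budgets; in the intermediate vertex that is reached, the winner of the bidding moves the
token along an edge, and the action of the other player is irrelevant. (The transitions for
actions that are not allowed are irrelevant too.) -/
def concurrent : ConcurrentArena (Action V N) (Position V Q N) where
  allowed
    | .config c, i => {a | ∃ b : Fin (N + 1), (b : ℕ) ≤ c.budget i ∧ a = .bid b}
    | .inter c b₁ b₂, i =>
      {a | i = G.winner c b₁ b₂ → ∃ v ∈ G.edge c.vertex, a = .move v}
  allowed_nonempty
    | .config _, _ => ⟨.bid 0, 0, by simp, rfl⟩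
    | .inter c _ _, _ =>
      let ⟨v, hv⟩ := G.edge_nonempty c.vertex
      ⟨.move v, fun _ => ⟨v, hv, rfl⟩⟩
  next
    | .config c, .bid b₁, .bid b₂ => .inter c b₁ b₂
    | .inter c b₁ b₂, a₁, a₂ =>
      match (match G.winner c b₁ b₂ with | .one => a₁ | .two => a₂) with
      | .move v => .config (G.outcome c b₁ b₂ v)
      | .bid _ => .inter c b₁ b₂
    | .config c, _, _ => .config c

/-- The tie-breaking transducer is un-aware of ties: it does not see whether a tie occurred. -/
def UnawareOfTies : Prop :=
  ∀ s v i b, G.transducer.step s (v, i, true, b) = G.transducer.step s (v, i, false, b)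

end BiddingArena

/-! ### Decision problems and polynomial-time reductions -/

/-- A decision problem: instances, their encoding as bit strings, and the yes-instances. -/
structure DecisionProblem where
  Instance : Type
  encode : Instance → List Bool
  encode_injective : Function.Injective encode
  Yes : Instance → Prop

/-- Polynomial-time many-one reducibility. -/
def PolyTimeReducible (P R : DecisionProblem) : Prop :=
  ∃ f : P.Instance → R.Instance,
    Nonempty (Turing.TM2ComputableInPolyTime P.encode R.encode f) ∧ ∀ x, P.Yes x ↔ R.Yes (f x)

/-- Two problems have the same complexity: each is polynomial-time many-one reducible to the
other. -/
def SameComplexity (P R : DecisionProblem) : Prop :=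
  PolyTimeReducible P R ∧ PolyTimeReducible R P

/-- The code of a player. -/
def Player.code : Player → ℕ
  | .one => 0
  | .two => 1

theorem Player.code_injective : Function.Injective Player.code := by
  intro i j h
  cases i <;> cases j <;> simp_all [Player.code]

/-- An instance of `TB-WIN`: a finite turn-based game with objective `α`, and an initial vertex. -/
structure TBInstance (α : QualitativeObjective) where
  numActions : ℕ
  numVertices : ℕ
  arena : ConcurrentArena (Fin numActions) (Fin numVertices)
  turnBased : arena.IsTurnBased
  data : α.Data
  colour : Fin numVertices → Fin (α.numColours data)
  start : Fin numVertices

/-- Explicit description of a turn-based game by lists of its components. -/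
noncomputable def TBInstance.code {α : QualitativeObjective} (I : TBInstance α) : List ℕ :=
  [I.numActions, I.numVertices, I.start] ++
  (table fun v => table fun a => [bit (a ∈ I.arena.allowed v .one), bit (a ∈ I.arena.allowed v .two)]) ++
  (table fun v => table fun a => table fun b => [(I.arena.next v a b : ℕ)]) ++
  (table fun v => [(I.colour v : ℕ)]) ++
  α.code I.data

/-- An instance of `BID-WIN`: a finite bidding game with transducer-based tie-breaking and objective
`α`, and an initial configuration. -/
structure BidInstance (α : QualitativeObjective) where
  numVertices : ℕ
  numStates : ℕ
  totalBudget : ℕ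
  arena : BiddingArena (Fin numVertices) (Fin numStates) totalBudget
  data : α.Data
  colour : Fin numVertices → Fin (α.numColours data)
  start : Config (Fin numVertices) (Fin numStates) totalBudget

/-- Explicit description of a bidding game by lists of its components. -/
noncomputable def BidInstance.code {α : QualitativeObjective} (I : BidInstance α) : List ℕ :=
  [I.numVertices, I.numStates, I.totalBudget,
    I.start.vertex, I.start.budgetOne, I.start.state, I.arena.transducer.init] ++
  (table fun v => table fun u => [bit (u ∈ I.arena.edge v)]) ++
  (table fun s => [(I.arena.transducer.label s).code]) ++
  (table fun s => table fun v => table fun b =>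
    [(I.arena.transducer.step s (v, .one, false, b) : ℕ),
      (I.arena.transducer.step s (v, .one, true, b) : ℕ),
      (I.arena.transducer.step s (v, .two, false, b) : ℕ),
      (I.arena.transducer.step s (v, .two, true, b) : ℕ)]) ++
  (table fun v => [(I.colour v : ℕ)]) ++
  α.code I.data

theorem TBInstance.code_injective {α : QualitativeObjective} :
    Function.Injective (TBInstance.code (α := α)) := by
  rintro ⟨m, n, ⟨al, hal, nx⟩, tb, d, col, st⟩ ⟨m', n', ⟨al', hal', nx'⟩, tb', d', col', st'⟩ h
  simp only [TBInstance.code, List.cons_append, List.nil_append, List.append_assoc,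
    List.cons.injEq] at h
  obtain ⟨rfl, rfl, h1, h⟩ := h
  obtain ⟨h2, h⟩ := table_append_inj (L := m * 2)
    (fun _ => table_length fun _ => rfl) (fun _ => table_length fun _ => rfl) h
  obtain ⟨h3, h⟩ := table_append_inj (L := m * (m * 1))
    (fun _ => table_length fun _ => table_length fun _ => rfl)
    (fun _ => table_length fun _ => table_length fun _ => rfl) h
  obtain ⟨h4, h⟩ := table_append_inj (L := 1) (fun _ => rfl) (fun _ => rfl) h
  obtain rfl := α.code_injective h
  obtain rfl : st = st' := Fin.ext h1
  obtain rfl : col = col' := by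
    funext v
    have := congrFun h4 v
    simp only [List.cons.injEq, and_true] at this
    exact Fin.ext this
  obtain rfl : nx = nx' := by
    funext v a b
    have := congrFun (table_inj (L := 1) (fun _ => rfl) (fun _ => rfl)
      (congrFun (table_inj (L := m * 1) (fun _ => table_length fun _ => rfl)
        (fun _ => table_length fun _ => rfl) (congrFun h3 v)) a)) b
    simp only [List.cons.injEq, and_true] at this
    exact Fin.ext this
  obtain rfl : al = al' := by
    funext v i
    ext a
    have := congrFun (table_inj (L := 2) (fun _ => rfl) (fun _ => rfl) (congrFun h2 v)) a
    simp only [List.cons.injEq, and_true] at this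
    cases i
    · exact bit_inj this.1
    · exact bit_inj this.2
  rfl

theorem BidInstance.code_injective {α : QualitativeObjective} :
    Function.Injective (BidInstance.code (α := α)) := by
  rintro ⟨n, q, N, ⟨E, hE, ⟨q0, st, lb⟩⟩, d, col, ⟨v, B, s⟩⟩
    ⟨n', q', N', ⟨E', hE', ⟨q0', st', lb'⟩⟩, d', col', ⟨v', B', s'⟩⟩ h
  simp only [BidInstance.code, List.cons_append, List.nil_append, List.append_assoc,
    List.cons.injEq] at h
  obtain ⟨rfl, rfl, rfl, hv, hB, hs, hq, h⟩ := h
  obtain ⟨h1, h⟩ := table_append_inj (L := n * 1)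
    (fun _ => table_length fun _ => rfl) (fun _ => table_length fun _ => rfl) h
  obtain ⟨h2, h⟩ := table_append_inj (L := 1) (fun _ => rfl) (fun _ => rfl) h
  obtain ⟨h3, h⟩ := table_append_inj (L := n * ((N + 1) * 4))
    (fun _ => table_length fun _ => table_length fun _ => rfl)
    (fun _ => table_length fun _ => table_length fun _ => rfl) h
  obtain ⟨h4, h⟩ := table_append_inj (L := 1) (fun _ => rfl) (fun _ => rfl) h
  obtain rfl := α.code_injective h
  obtain rfl : v = v' := Fin.ext hv
  obtain rfl : B = B' := Fin.ext hB
  obtain rfl : s = s' := Fin.ext hs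
  obtain rfl : q0 = q0' := Fin.ext hq
  obtain rfl : col = col' := by
    funext v
    have := congrFun h4 v
    simp only [List.cons.injEq, and_true] at this
    exact Fin.ext this
  obtain rfl : lb = lb' := by
    funext v
    have := congrFun h2 v
    simp only [List.cons.injEq, and_true] at this
    exact Player.code_injective this
  obtain rfl : E = E' := by
    funext v
    ext u
    have := congrFun (table_inj (L := 1) (fun _ => rfl) (fun _ => rfl) (congrFun h1 v)) u
    simp only [List.cons.injEq, and_true] at this
    exact bit_inj this
  obtain rfl : st = st' := by
    funext s ⟨v, i, t, b⟩
    have := congrFun (table_inj (L := 4) (fun _ => rfl) (fun _ => rfl)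
      (congrFun (table_inj (L := (N + 1) * 4) (fun _ => table_length fun _ => rfl)
        (fun _ => table_length fun _ => rfl) (congrFun h3 s)) v)) b
    simp only [List.cons.injEq, and_true] at this
    obtain ⟨ha, hb, hc, hd⟩ := this
    cases i <;> cases t
    · exact Fin.ext ha
    · exact Fin.ext hb
    · exact Fin.ext hc
    · exact Fin.ext hd
  rfl

/-- `TB-WIN`: given a turn-based game with objective `α` and a vertex, does Player 1 have a winning
strategy from that vertex? -/
noncomputable def tbWin (α : QualitativeObjective) : DecisionProblem where
  Instance := TBInstance α
  encode I := unary I.code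
  encode_injective := unary_injective.comp TBInstance.code_injective
  Yes I := I.arena.PlayerOneWins (α.winningPaths I.data I.colour) I.start

/-- `BID-WIN`: given a bidding game with transducer-based tie-breaking, objective `α` and budgets in
unary, and a configuration, does Player 1 have a winning strategy from that configuration? An
intermediate vertex has the colour of the token's location, hence does not contribute to the
objective. -/
noncomputable def bidWin (α : QualitativeObjective) : DecisionProblem where
  Instance := BidInstance α
  encode I := unary I.code
  encode_injective := unary_injective.comp BidInstance.code_injective
  Yes I := I.arena.concurrent.PlayerOneWins
    (α.winningPaths I.data fun p => I.colour p.token) (.config I.start)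

/-- The restriction of `BID-WIN` to bidding games whose transducer is un-aware of ties. -/
noncomputable def bidWinUnaware (α : QualitativeObjective) : DecisionProblem where
  Instance := {I : BidInstance α // I.arena.UnawareOfTies}
  encode I := (bidWin α).encode I.1
  encode_injective := (bidWin α).encode_injective.comp Subtype.val_injective
  Yes I := (bidWin α).Yes I.1

end BiddingGames

/-!
Every bidding game is equivalent to a turn-based game of polynomial size, and every turn-based game
to a bidding game without money.

*From bidding games to turn-based games.* Strategies are pure, so Player 1 wins a concurrent game
if and only if he wins the game in which he announces his action before Player 2 chooses: knowing
the history, Player 2 knows the action of a fixed strategy anyway. In terms of `Forces`, all that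
matters in a vertex is which sets of successors one action of Player 1 can guarantee
(`playerOneWins_iff`). Hence every round of the concurrent game of configurations can be played
as a short sequence of turns, each consisting of one choice of one player (`sequential`). As the
budget is given in unary, the number of intermediate positions is polynomial in the size of the
bidding game.

*From turn-based games to bidding games.* With total budget 0 both bids are 0 in every round, so
every round is a tie. The transducer remembers the vertex of the token and names its owner, so the
owner of the vertex moves the token (`toBidding`). As every round is a tie, this transducer has no
need to look at the tie flag.

Both constructions play one round of a game in two rounds of another, during which the colour seen
by the objective is repeated. The sets of colours visited, and visited infinitely often, do not
change, so neither does the winner of the play (`playerOneWins_double`).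

*Polynomial time.* The instances are coded by tables, and each table of an output is a nested loop
that emits, for each tuple of indices, an arithmetic expression over the input. The languages
`Expr` and `Emit` describe such outputs. They are compiled to structured programs on stacks
(`Prog`) with numbers in unary, and these to machines of the type `Turing.FinTM2`. The result
`Emit.computableInPolyTime` reduces the claim of polynomial time to an equation between the
emitted list and the code of the constructed game.
-/

/-! ### Structured programs over stacks, and their compilation to Turing machines -/

namespace BiddingGames

open Turing

/-- Structured programs over stacks of bits that are indexed by `K`. The program `pop k p again`
pops the stack `k`, continues with `p o` for the symbol `o` that was found (`none` if the stack was
empty), and afterwards starts all over if `again o`; it serves as a conditional as well as a loop.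
-/
inductive Prog (K : Type)
  | skip
  | push (k : K) (b : Bool)
  | seq (p q : Prog K)
  | pop (k : K) (p : Option Bool → Prog K) (again : Option Bool → Bool)

namespace Prog

variable {K : Type}

/-- `p.Runs S S' n`: started with the stacks `S`, the program `p` ends with the stacks `S'` after at
most `n` steps. -/
inductive Runs [DecidableEq K] :
    Prog K → (K → List Bool) → (K → List Bool) → ℕ → Prop
  | skip (S : K → List Bool) : Runs skip S S 1
  | push (S : K → List Bool) (k : K) (b : Bool) :
      Runs (push k b) S (Function.update S k (b :: S k)) 1
  | seq {p q : Prog K} {S S' S'' : K → List Bool} {m n : ℕ} :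
      Runs p S S' m → Runs q S' S'' n → Runs (seq p q) S S'' (m + n)
  | exit {k : K} {p : Option Bool → Prog K} {again : Option Bool → Bool} {S S' : K → List Bool}
      {n : ℕ} : again (S k).head? = false →
      Runs (p (S k).head?) (Function.update S k (S k).tail) S' n →
      Runs (pop k p again) S S' (n + 1)
  | again {k : K} {p : Option Bool → Prog K} {again : Option Bool → Bool}
      {S S' S'' : K → List Bool} {m n : ℕ} : again (S k).head? = true →
      Runs (p (S k).head?) (Function.update S k (S k).tail) S' m →
      Runs (pop k p again) S' S'' n → Runs (pop k p again) S S'' (m + n + 1)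
  | mono {p : Prog K} {S S' : K → List Bool} {m n : ℕ} : Runs p S S' m → m ≤ n → Runs p S S' n

/-- The stacks that occur in a program. -/
def registers [DecidableEq K] : Prog K → Finset K
  | skip => ∅
  | push k _ => {k}
  | seq p q => p.registers ∪ q.registers
  | pop k p _ => insert k (Finset.univ.biUnion fun o => (p o).registers)

/-- The labels of the machine that executes a program. -/
def Label : Prog K → Type
  | skip => Unit
  | push _ _ => Unit
  | seq p q => p.Label ⊕ q.Label
  | pop _ p _ => Option (Σ o : Option Bool, (p o).Label)

theorem finite_label (p : Prog K) : Finite p.Label := by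
  induction p with
  | skip => exact inferInstanceAs (Finite Unit)
  | push => exact inferInstanceAs (Finite Unit)
  | seq p q hp hq => exact inferInstanceAs (Finite (p.Label ⊕ q.Label))
  | pop k p _ hp => exact inferInstanceAs (Finite (Option (Σ o : Option Bool, (p o).Label)))

/-- The label at which the execution of a program begins. -/
def start : (p : Prog K) → p.Label
  | skip => ()
  | push _ _ => ()
  | seq p _ => Sum.inl p.start
  | pop _ _ _ => (none : Option _)

/-- The statements of a machine that executes a program and then jumps to `exit`. Here `e` embeds
the labels of the program into those of the machine, and `f` its stacks into those of the machine.
The internal state of the machine is the symbol that was popped last. -/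
def stmt {K' Λ : Type} (f : K → K') : (p : Prog K) → (e : p.Label → Λ) → (exit : Λ) → p.Label →
    TM2.Stmt (fun _ : K' => Bool) Λ (Option Bool)
  | skip, _, exit, _ => .goto fun _ => exit
  | push k b, _, exit, _ => .push (f k) (fun _ => b) (.goto fun _ => exit)
  | seq p q, e, exit, l =>
    match l with
    | Sum.inl l => p.stmt f (fun l => e (Sum.inl l)) (e (Sum.inr q.start)) l
    | Sum.inr l => q.stmt f (fun l => e (Sum.inr l)) exit l
  | pop k p again, e, exit, l =>
    match l with
    | none => .pop (f k) (fun _ o => o) (.goto fun o => e (some ⟨o, (p o).start⟩))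
    | some ⟨o, l⟩ =>
      (p o).stmt f (fun l => e (some ⟨o, l⟩)) (if again o then e none else exit) l

end Prog

/-- The machine `M` gets from the configuration `c` to `c'` in at most `n` steps. -/
def ReachesIn {K Λ σ : Type} {Γ : K → Type} [DecidableEq K] (M : Λ → TM2.Stmt Γ Λ σ) (n : ℕ)
    (c c' : TM2.Cfg Γ Λ σ) : Prop :=
  ∃ m ≤ n, (flip bind (TM2.step M))^[m] (some c) = some c'

theorem ReachesIn.trans {K Λ σ : Type} {Γ : K → Type} [DecidableEq K] {M : Λ → TM2.Stmt Γ Λ σ}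
    {m n : ℕ} {c c' c'' : TM2.Cfg Γ Λ σ} (h : ReachesIn M m c c') (h' : ReachesIn M n c' c'') :
    ReachesIn M (m + n) c c'' := by
  obtain ⟨i, hi, h⟩ := h
  obtain ⟨j, hj, h'⟩ := h'
  exact ⟨j + i, by omega, by rw [Function.iterate_add_apply, h, h']⟩

theorem ReachesIn.single {K Λ σ : Type} {Γ : K → Type} [DecidableEq K] {M : Λ → TM2.Stmt Γ Λ σ}
    {c c' : TM2.Cfg Γ Λ σ} (h : TM2.step M c = some c') : ReachesIn M 1 c c' :=
  ⟨1, le_rfl, h⟩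

theorem comp_update_of_leftInverse {K K' X : Type} [DecidableEq K] [DecidableEq K']
    {f : K → K'} {g : K' → K} (hg : Function.Injective g) {k : K} (hk : g (f k) = k)
    (S : K → X) (x : X) :
    Function.update (S ∘ g) (f k) x = Function.update S k x ∘ g := by
  rw [← hk, Function.update_comp_eq_of_injective _ hg, hk]

/-- Correctness of the compilation: a machine that contains the statements of `p` executes `p`. -/
theorem Prog.Runs.reachesIn {K K' Λ : Type} [DecidableEq K] [DecidableEq K'] {f : K → K'}
    {g : K' → K} (hg : Function.Injective g) {M : Λ → TM2.Stmt (fun _ : K' => Bool) Λ (Option Bool)}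
    {p : Prog K} {S S' : K → List Bool} {n : ℕ} (h : p.Runs S S' n) :
    ∀ (e : p.Label → Λ) (exit : Λ), (∀ k ∈ p.registers, g (f k) = k) →
      (∀ l, M (e l) = p.stmt f e exit l) → ∀ v, ∃ v',
      ReachesIn M n ⟨some (e p.start), v, S ∘ g⟩ ⟨some exit, v', S' ∘ g⟩ := by
  induction h with
  | skip S =>
    intro e exit _ hM v
    refine ⟨v, .single ?_⟩
    simp only [TM2.step, hM]
    rfl
  | push S k b =>
    intro e exit hf hM v
    refine ⟨v, .single ?_⟩
    have hk := hf k (by simp [registers])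
    simp only [TM2.step, hM, ← comp_update_of_leftInverse hg hk]
    simp [stmt, TM2.stepAux, hk]
  | @seq p q S S' S'' m n _ _ ihp ihq =>
    intro e exit hf hM v
    obtain ⟨v', h'⟩ := ihp (fun l => e (Sum.inl l)) (e (Sum.inr q.start))
      (fun k hk => hf k (by simp [registers, hk])) (fun l => hM (Sum.inl l)) v
    obtain ⟨v'', h''⟩ := ihq (fun l => e (Sum.inr l)) exit
      (fun k hk => hf k (by simp [registers, hk])) (fun l => hM (Sum.inr l)) v'
    exact ⟨v'', h'.trans h''⟩
  | @exit k p again S S' n hag _ ih =>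
    intro e exit hf hM v
    have hk := hf k (by simp [registers])
    obtain ⟨v', h'⟩ := ih (fun l => e (some ⟨_, l⟩)) exit
      (fun k hk => hf k (by
        simp only [registers, Finset.mem_insert, Finset.mem_biUnion]
        exact .inr ⟨_, Finset.mem_univ _, hk⟩))
      (fun l => by rw [hM (some ⟨_, l⟩)]; simp [stmt, hag]) (S k).head?
    refine ⟨v', ?_⟩
    rw [add_comm]
    refine ReachesIn.trans (.single ?_) h'
    simp only [TM2.step, start, ← comp_update_of_leftInverse hg hk]
    rw [hM (none : Option _)]
    simp only [stmt, TM2.stepAux, Function.comp_apply]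
    rw [hk]
  | @again k p again S S' S'' m n hag _ _ ih ih' =>
    intro e exit hf hM v
    have hk := hf k (by simp [registers])
    obtain ⟨v', h'⟩ := ih (fun l => e (some ⟨_, l⟩)) (e (none : Option _))
      (fun k hk => hf k (by
        simp only [registers, Finset.mem_insert, Finset.mem_biUnion]
        exact .inr ⟨_, Finset.mem_univ _, hk⟩))
      (fun l => by rw [hM (some ⟨_, l⟩)]; simp [stmt, hag]) (S k).head?
    obtain ⟨v'', h''⟩ := ih' e exit hf hM v'
    refine ⟨v'', ?_⟩
    rw [add_comm]
    refine ReachesIn.trans (.single ?_) (h'.trans h'')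
    simp only [TM2.step, start, ← comp_update_of_leftInverse hg hk]
    rw [hM (none : Option _)]
    simp only [stmt, TM2.stepAux, Function.comp_apply]
    rw [hk]
  | mono _ hmn ih =>
    intro e exit hf hM v
    obtain ⟨v', i, hi, h'⟩ := ih e exit hf hM v
    exact ⟨v', i, hi.trans hmn, h'⟩

/-- A function is computable in polynomial time if a structured program, run on the code of the
argument on the stack `inp` and empty stacks otherwise, ends in polynomial time with the code of the
value on the stack `out` and empty stacks otherwise. -/
theorem Prog.computableInPolyTime {K X Y : Type} [DecidableEq K] (p : Prog K) (inp out : K)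
    (eX : X → List Bool) (eY : Y → List Bool) (F : X → Y) (time : Polynomial ℕ)
    (h : ∀ x, p.Runs (Function.update (fun _ => []) inp (eX x))
      (Function.update (fun _ => []) out (eY (F x))) (time.eval (eX x).length)) :
    Nonempty (TM2ComputableInPolyTime eX eY F) := by
  classical
  -- Only the finitely many stacks in `s` are kept.
  let s : Finset K := insert inp (insert out p.registers)
  let K' : Type := {k // k ∈ s}
  let k₀ : K' := ⟨inp, by simp [s]⟩
  let k₁ : K' := ⟨out, by simp [s]⟩
  let f : K → K' := fun k => if hk : k ∈ s then ⟨k, hk⟩ else k₀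
  let M : Option p.Label → TM2.Stmt (fun _ : K' => Bool) (Option p.Label) (Option Bool) := fun l =>
    match l with
    | none => .load (fun _ => none) .halt
    | some l => p.stmt f some none l
  have : Finite p.Label := p.finite_label
  have : Fintype (Option p.Label) := Fintype.ofFinite _
  let tm : FinTM2 :=
    { K := K', k₀ := k₀, k₁ := k₁, Γ := fun _ => Bool, Λ := Option p.Label
      main := some p.start, σ := Option Bool, initialState := none, m := M }
  have key : ∀ x, ReachesIn M (time.eval (eX x).length + 1)
      ⟨some (some p.start), none, Function.update (fun _ => []) inp (eX x) ∘ Subtype.val⟩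
      ⟨none, none, Function.update (fun _ => []) out (eY (F x)) ∘ Subtype.val⟩ := by
    intro x
    obtain ⟨v, hv⟩ := (h x).reachesIn (f := f) (g := Subtype.val) (M := M) Subtype.val_injective
      some none (fun k hk => by
        have : k ∈ s := by simp [s, hk]
        simp [f, this]) (fun l => rfl) none
    exact hv.trans (.single rfl)
  have hstk : ∀ (k : K') (w : List Bool),
      (Function.update (fun _ => []) k.1 w ∘ Subtype.val : K' → List Bool) =
        fun j => if j = k then w else [] := by
    intro k w
    funext j
    by_cases hj : j = k
    · simp [hj]
    · simp [hj, Subtype.val_injective.ne hj]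
  choose m hm hm' using key
  refine ⟨{ tm := tm, inputAlphabet := Equiv.refl _, outputAlphabet := Equiv.refl _
            time := time + 1, outputsFun := fun x => ⟨⟨m x, ?_⟩, ?_⟩ }⟩
  · have hin : initList tm (List.map (Equiv.refl Bool).invFun (eX x)) =
        ⟨some (some p.start), none, Function.update (fun _ => []) inp (eX x) ∘ Subtype.val⟩ := by
      rw [hstk k₀]
      simp only [initList, Equiv.invFun_as_coe, Equiv.refl_symm, Equiv.coe_refl, List.map_id]
      congr 1
    have hout : haltList tm (List.map (Equiv.refl Bool).invFun (eY (F x))) =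
        ⟨none, none, Function.update (fun _ => []) out (eY (F x)) ∘ Subtype.val⟩ := by
      rw [hstk k₁]
      simp only [haltList, Equiv.invFun_as_coe, Equiv.refl_symm, Equiv.coe_refl, List.map_id]
      congr 1
    refine (?_ : _ = some (haltList tm _))
    rw [hout]
    refine (?_ : _^[m x] (some (initList tm (List.map (Equiv.refl Bool).invFun (eX x)))) = _)
    rw [hin]
    exact hm' x
  · simpa using hm x

end BiddingGames

/-! ### A language of polynomial-time expressions and its compilation -/

namespace BiddingGames

open Turing

/-- The stacks of compiled programs: input, output, an auxiliary stack, and the counters that hold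
(in unary) the values of variables and intermediate results. -/
inductive Reg
  | inp
  | out
  | aux
  | var (x : ℕ)
  | tmp (d : ℕ)
  deriving DecidableEq

/-- The contents of the stacks: `i` is the input, `a` the auxiliary stack, `o` the output, and `ρ`
and `τ` are the values of the variables and of the intermediate results. -/
def mem (i a o : List Bool) (ρ τ : ℕ → ℕ) : Reg → List Bool
  | .inp => i
  | .out => o
  | .aux => a
  | .var x => List.replicate (ρ x) true
  | .tmp d => List.replicate (τ d) true

namespace Prog

/-- Push `b` on each of the stacks `ks`. -/
def pushAll (b : Bool) : List Reg → Prog Reg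
  | [] => skip
  | k :: ks => seq (push k b) (pushAll b ks)

/-- Pop everything from `k`, and push every symbol on each of the stacks `ks`. -/
def move (k : Reg) (ks : List Reg) : Prog Reg :=
  pop k (fun o => match o with | none => skip | some b => pushAll b ks) Option.isSome

/-- Repeat `body` while the counter `k` can be decreased. -/
def count (k : Reg) (body : Prog Reg) : Prog Reg :=
  pop k (fun o => match o with | none => skip | some _ => body) Option.isSome

theorem Runs.of_eq {p : Prog Reg} {S S' S'' : Reg → List Bool} {n : ℕ} (h : p.Runs S S' n)
    (h' : S' = S'') : p.Runs S S'' n := h' ▸ h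

theorem runs_pushAll (b : Bool) (ks : List Reg) (hks : ks.Nodup) (S : Reg → List Bool) :
    (pushAll b ks).Runs S (fun r => if r ∈ ks then b :: S r else S r) (ks.length + 1) := by
  induction ks generalizing S with
  | nil => exact (Runs.skip S).of_eq (by simp)
  | cons k ks ih =>
    have hk := List.nodup_cons.1 hks
    refine ((Runs.push S k b).seq (ih hk.2 _)).of_eq ?_ |>.mono (by simp; omega)
    funext r
    by_cases h : r = k
    · subst h; simp [hk.1]
    · simp [h]

theorem runs_move (k : Reg) (ks : List Reg) (hks : (k :: ks).Nodup) (hl : ks.length ≤ 2)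
    (S : Reg → List Bool) :
    (move k ks).Runs S
      (fun r => if r = k then [] else if r ∈ ks then (S k).reverse ++ S r else S r)
      (4 * (S k).length + 2) := by
  obtain ⟨w, hw⟩ : ∃ w, w = S k := ⟨_, rfl⟩
  induction w generalizing S with
  | nil =>
    refine (Runs.exit (by simp [← hw]) ?_ : (move k ks).Runs S _ (1 + 1)).mono (by omega)
    rw [← hw]
    refine (Runs.skip _).of_eq ?_
    funext r
    by_cases h : r = k
    · subst h; simp
    · simp [h]
  | cons b w ih =>
    have hk := List.nodup_cons.1 hks
    set S₁ : Reg → List Bool := fun r => if r ∈ ks then b :: Function.update S k w r else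
      Function.update S k w r with hS₁
    have h1 := runs_pushAll b ks hk.2 (Function.update S k w)
    have hw₁ : w = S₁ k := by simp [hS₁, hk.1]
    have h2 := ih S₁ hw₁
    have h3 : (move k ks).Runs S _ _ := Runs.again (by simp [← hw])
      (by rw [← hw]; exact h1) h2
    refine (h3.of_eq ?_).mono (by rw [← hw₁, ← hw]; simp; omega)
    funext r
    by_cases h : r = k
    · simp [h]
    · by_cases h' : r ∈ ks
      · simp [h, h', ← hw, hS₁, hk.1]
      · simp [h, h', hS₁]

/-- A loop over a counter `k`, with the invariant `I j` when the counter has the value `j`. -/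
theorem runs_count {k : Reg} {body : Prog Reg} (I : ℕ → Reg → List Bool) (n t : ℕ)
    (hI : ∀ j, I j k = List.replicate j true)
    (hb : ∀ j < n, body.Runs (Function.update (I (j + 1)) k (List.replicate j true)) (I j) t) :
    (count k body).Runs (I n) (I 0) (n * (t + 1) + 2) := by
  induction n with
  | zero =>
    have h0 := hI 0
    refine (Runs.exit (by simp [h0]) ?_ : (count k body).Runs (I 0) _ (1 + 1)).mono (by omega)
    rw [h0]
    refine (Runs.skip _).of_eq ?_
    simp [h0]
  | succ n ih =>
    have h1 := hb n (by omega)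
    have h0 := hI (n + 1)
    have h2 := ih fun j hj => hb j (by omega)
    refine (Runs.again (by simp [h0, List.replicate_succ]) ?_ h2 :
      (count k body).Runs (I (n + 1)) _ (t + _ + 1)).mono (by ring_nf; omega)
    rw [h0, List.replicate_succ]
    simpa using h1

end Prog

open Prog

section memory

variable {i a o : List Bool} {ρ τ : ℕ → ℕ}

theorem update_var (x n : ℕ) :
    Function.update (mem i a o ρ τ) (.var x) (List.replicate n true) =
      mem i a o (Function.update ρ x n) τ := by
  funext r
  cases r with
  | var y => by_cases h : y = x <;> simp [mem, h]
  | _ => simp [mem]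

theorem update_tmp (d n : ℕ) :
    Function.update (mem i a o ρ τ) (.tmp d) (List.replicate n true) =
      mem i a o ρ (Function.update τ d n) := by
  funext r
  cases r with
  | tmp y => by_cases h : y = d <;> simp [mem, h]
  | _ => simp [mem]

theorem update_inp (w : List Bool) :
    Function.update (mem i a o ρ τ) .inp w = mem w a o ρ τ := by
  funext r
  cases r <;> simp [mem]

theorem update_aux (w : List Bool) :
    Function.update (mem i a o ρ τ) .aux w = mem i w o ρ τ := by
  funext r
  cases r <;> simp [mem]

theorem update_out (w : List Bool) :
    Function.update (mem i a o ρ τ) .out w = mem i a w ρ τ := by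
  funext r
  cases r <;> simp [mem]

theorem runs_push_tmp (d : ℕ) : (push (.tmp d) true).Runs (mem i a o ρ τ)
    (mem i a o ρ (Function.update τ d (τ d + 1))) 1 :=
  (Runs.push _ _ _).of_eq (by rw [← update_tmp]; rfl)

theorem runs_push_aux (b : Bool) :
    (push .aux b).Runs (mem i a o ρ τ) (mem i (b :: a) o ρ τ) 1 :=
  (Runs.push _ _ _).of_eq (update_aux _)

theorem runs_push_out (b : Bool) :
    (push .out b).Runs (mem i a o ρ τ) (mem i a (b :: o) ρ τ) 1 :=
  (Runs.push _ _ _).of_eq (update_out _)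

theorem runs_clear_tmp (d : ℕ) : (move (.tmp d) []).Runs (mem i a o ρ τ)
    (mem i a o ρ (Function.update τ d 0)) (4 * τ d + 2) := by
  refine ((runs_move _ _ (by simp) (by simp) _).of_eq ?_).mono (by simp [mem])
  rw [← update_tmp]
  funext r
  simp [Function.update_apply]

theorem runs_clear_inp : (move .inp []).Runs (mem i a o ρ τ)
    (mem [] a o ρ τ) (4 * i.length + 2) := by
  refine ((runs_move _ _ (by simp) (by simp) _).of_eq ?_).mono (by simp [mem])
  funext r
  cases r <;> simp [mem]

theorem runs_move_tmp_tmp {d d' : ℕ} (h : d ≠ d') : (move (.tmp d) [.tmp d']).Runs (mem i a o ρ τ)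
    (mem i a o ρ (Function.update (Function.update τ d' (τ d + τ d')) d 0)) (4 * τ d + 2) := by
  refine ((runs_move _ _ (by simp [h]) (by simp) _).of_eq ?_).mono (by simp [mem])
  rw [← update_tmp, ← update_tmp]
  funext r
  by_cases h1 : r = .tmp d
  · simp [h1]
  · by_cases h2 : r = .tmp d'
    · simp [h2, mem, h.symm]
    · simp [h1, h2]

theorem runs_move_tmp_out (d : ℕ) : (move (.tmp d) [.out]).Runs (mem i a o ρ τ)
    (mem i a (List.replicate (τ d) true ++ o) ρ (Function.update τ d 0)) (4 * τ d + 2) := by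
  refine ((runs_move _ _ (by simp) (by simp) _).of_eq ?_).mono (by simp [mem])
  funext r
  cases r with
  | tmp y => by_cases h : y = d <;> simp [mem, h]
  | _ => simp [mem]

theorem runs_move_var_tmp (x d : ℕ) : (move (.var x) [.tmp d]).Runs (mem i a o ρ τ)
    (mem i a o (Function.update ρ x 0) (Function.update τ d (ρ x + τ d))) (4 * ρ x + 2) := by
  refine ((runs_move _ _ (by simp) (by simp) _).of_eq ?_).mono (by simp [mem])
  rw [← update_tmp, ← update_var]
  funext r
  by_cases h1 : r = .var x
  · simp [h1]
  · by_cases h2 : r = .tmp d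
    · simp [h2, mem]
    · simp [h1, h2]

theorem runs_move_tmp_var (d x : ℕ) : (move (.tmp d) [.var x]).Runs (mem i a o ρ τ)
    (mem i a o (Function.update ρ x (τ d + ρ x)) (Function.update τ d 0)) (4 * τ d + 2) := by
  refine ((runs_move _ _ (by simp) (by simp) _).of_eq ?_).mono (by simp [mem])
  rw [← update_tmp, ← update_var]
  funext r
  by_cases h1 : r = .tmp d
  · simp [h1]
  · by_cases h2 : r = .var x
    · simp [h2, mem]
    · simp [h1, h2]

theorem runs_move_aux_inp : (move .aux [.inp]).Runs (mem i a o ρ τ)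
    (mem (a.reverse ++ i) [] o ρ τ) (4 * a.length + 2) := by
  refine ((runs_move _ _ (by simp) (by simp) _).of_eq ?_).mono (by simp [mem])
  funext r
  cases r <;> simp [mem]

theorem runs_copy_var (x d : ℕ) :
    (seq (move (.var x) [.aux, .tmp d]) (move .aux [.var x])).Runs (mem i [] o ρ τ)
      (mem i [] o ρ (Function.update τ d (ρ x + τ d))) (8 * ρ x + 4) := by
  refine (((runs_move _ _ (by simp) (by simp) _).seq
    (runs_move _ _ (by simp) (by simp) _)).of_eq ?_).mono (by simp [mem]; omega)
  rw [← update_tmp]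
  funext r
  cases r with
  | tmp y => by_cases h : y = d <;> simp [mem, h]
  | var y => by_cases h : y = x <;> simp [mem, h]
  | _ => simp [mem]

theorem runs_copy_tmp {d d' : ℕ} (hd : d ≠ d') :
    (seq (move (.tmp d) [.aux, .tmp d']) (move .aux [.tmp d])).Runs (mem i [] o ρ τ)
      (mem i [] o ρ (Function.update τ d' (τ d + τ d'))) (8 * τ d + 4) := by
  refine (((runs_move _ _ (by simp [hd]) (by simp) _).seq
    (runs_move _ _ (by simp) (by simp) _)).of_eq ?_).mono (by simp [mem]; omega)
  rw [← update_tmp]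
  funext r
  cases r with
  | tmp y =>
    by_cases h : y = d
    · simp [mem, h, hd]
    · by_cases h' : y = d' <;> simp [mem, h, h', hd.symm]
  | _ => simp [mem]

end memory

/-- Expressions over an input list `A` of natural numbers and variables, which are numbered. The
values of all expressions are polynomially bounded. -/
inductive Expr
  /-- a constant -/
  | const (n : ℕ)
  /-- the value of a variable -/
  | var (x : ℕ)
  /-- the entry of the input at the given index, or `0` if there is none -/
  | input (e : Expr)
  /-- the length of the input -/
  | len
  | add (e f : Expr)
  | mul (e f : Expr)
  /-- truncated subtraction -/
  | sub (e f : Expr)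
  /-- `e` if `c` is positive, and `f` otherwise -/
  | ifPos (c e f : Expr)
  /-- the sum of `f` over all values less than `e` of the variable `x` -/
  | sum (x : ℕ) (e f : Expr)

namespace Expr

/-- The value of an expression. -/
def eval (A : List ℕ) : Expr → (ℕ → ℕ) → ℕ
  | const n, _ => n
  | var x, ρ => ρ x
  | input e, ρ => A.getD (e.eval A ρ) 0
  | len, _ => A.length
  | add e f, ρ => e.eval A ρ + f.eval A ρ
  | mul e f, ρ => e.eval A ρ * f.eval A ρ
  | sub e f, ρ => e.eval A ρ - f.eval A ρ
  | ifPos c e f, ρ => if 0 < c.eval A ρ then e.eval A ρ else f.eval A ρ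
  | sum x e f, ρ => ∑ i ∈ Finset.range (e.eval A ρ), f.eval A (Function.update ρ x i)

/-- Move a number from the input to the auxiliary stack. -/
def skipNumber : Prog Reg :=
  .pop .inp (fun o => match o with | none => .skip | some b => .push .aux b) (· = some true)

/-- Move a number from the input to the auxiliary stack, and add it to a counter. -/
def readNumber (d : ℕ) : Prog Reg :=
  .pop .inp (fun o => match o with
    | none => .skip
    | some true => .seq (.push .aux true) (.push (.tmp d) true)
    | some false => .push .aux false) (· = some true)

/-- Add the number of entries of the input to a counter, and move the input to the auxiliary
stack. -/
def countNumbers (d : ℕ) : Prog Reg :=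
  .pop .inp (fun o => match o with
    | none => .skip
    | some true => .push .aux true
    | some false => .seq (.push .aux false) (.push (.tmp d) true)) Option.isSome

/-- The program that stores the value of an expression in the counter `tmp d`, using the counters
`tmp j` for `j > d` for intermediate results. In a sum, `tmp (d + 1)` keeps the old value of the
bound variable, which itself serves as the counter of the loop. -/
def compile : Expr → ℕ → Prog Reg
  | const n, d => (List.replicate n (.push (.tmp d) true)).foldr .seq .skip
  | var x, d => .seq (.move (.var x) [.aux, .tmp d]) (.move .aux [.var x])
  | input e, d => .seq (e.compile d) <| .seq (.count (.tmp d) skipNumber) <|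
      .seq (readNumber d) (.move .aux [.inp])
  | len, d => .seq (countNumbers d) (.move .aux [.inp])
  | add e f, d => .seq (e.compile d) <| .seq (f.compile (d + 1)) (.move (.tmp (d + 1)) [.tmp d])
  | mul e f, d => .seq (e.compile d) <| .seq (f.compile (d + 1)) <|
      .seq (.count (.tmp d)
        (.seq (.move (.tmp (d + 1)) [.aux, .tmp (d + 2)]) (.move .aux [.tmp (d + 1)]))) <|
      .seq (.move (.tmp (d + 1)) []) (.move (.tmp (d + 2)) [.tmp d])
  | sub e f, d => .seq (e.compile d) <| .seq (f.compile (d + 1)) <|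
      .count (.tmp (d + 1)) (.pop (.tmp d) (fun _ => .skip) fun _ => false)
  | ifPos c e f, d => .seq (c.compile d) <|
      .pop (.tmp d) (fun o => match o with
        | none => f.compile d
        | some _ => .seq (.move (.tmp d) []) (e.compile d)) fun _ => false
  | sum x e f, d => .seq (e.compile d) <| .seq (.move (.var x) [.tmp (d + 1)]) <|
      .seq (.move (.tmp d) [.var x]) <|
      .seq (.count (.var x) (.seq (f.compile (d + 2)) (.move (.tmp (d + 2)) [.tmp d]))) <|
      .move (.tmp (d + 1)) [.var x]

end Expr

theorem unary_cons (n : ℕ) (A : List ℕ) :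
    unary (n :: A) = List.replicate n true ++ false :: unary A := by
  simp [unary]

theorem unary_append (A B : List ℕ) : unary (A ++ B) = unary A ++ unary B := by
  simp [unary]

theorem length_le_length_unary (A : List ℕ) : A.length ≤ (unary A).length := by
  induction A with
  | nil => simp
  | cons n A ih => simp [unary_cons]; omega

theorem getD_le_length_unary (A : List ℕ) (j : ℕ) : A.getD j 0 ≤ (unary A).length := by
  induction A generalizing j with
  | nil => simp
  | cons n A ih =>
    cases j with
    | zero => simp [unary_cons]
    | succ j => have := ih j; simp [unary_cons] at this ⊢; omega

namespace Expr

theorem runs_skipNumber_aux (n : ℕ) (w a o : List Bool) (ρ τ : ℕ → ℕ) :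
    skipNumber.Runs (mem (List.replicate n true ++ false :: w) a o ρ τ)
      (mem w (false :: List.replicate n true ++ a) o ρ τ) (2 * n + 2) := by
  induction n generalizing a with
  | zero =>
    refine Runs.exit (by simp [mem]) (n := 1) ?_
    simp only [List.replicate_zero, List.nil_append]
    rw [show mem (false :: w) a o ρ τ .inp = false :: w from rfl, update_inp]
    exact runs_push_aux _
  | succ n ih =>
    refine (Runs.again (by simp [mem, List.replicate_succ]) ?_ (ih (true :: a)) (m := 1)).of_eq ?_
      |>.mono (by omega)
    · rw [show mem (List.replicate (n + 1) true ++ false :: w) a o ρ τ .inp =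
        true :: (List.replicate n true ++ false :: w) from rfl, update_inp]
      exact runs_push_aux _
    · rw [List.replicate_succ']; simp

theorem runs_skipNumber (B : List ℕ) (a o : List Bool) (ρ τ : ℕ → ℕ) {M : ℕ}
    (hM : (unary B).length ≤ M) :
    skipNumber.Runs (mem (unary B) a o ρ τ)
      (mem (unary B.tail) ((unary (B.take 1)).reverse ++ a) o ρ τ) (2 * M + 2) := by
  cases B with
  | nil =>
    refine (Runs.exit (by simp [mem, unary]) (n := 1) ?_).mono (by omega)
    rw [show mem (unary []) a o ρ τ .inp = [] from rfl, update_inp]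
    exact Runs.skip _
  | cons n B =>
    simp only [unary_cons, List.length_append, List.length_replicate] at hM
    rw [unary_cons]
    refine ((runs_skipNumber_aux n (unary B) a o ρ τ).of_eq ?_).mono (by omega)
    simp [unary]

theorem runs_readNumber_aux (n d : ℕ) (w a o : List Bool) (ρ τ : ℕ → ℕ) :
    (readNumber d).Runs (mem (List.replicate n true ++ false :: w) a o ρ τ)
      (mem w (false :: List.replicate n true ++ a) o ρ (Function.update τ d (n + τ d)))
      (3 * n + 2) := by
  induction n generalizing a τ with
  | zero =>
    refine (Runs.exit (by simp [mem]) (n := 1) (S' := mem w (false :: a) o ρ τ) ?_).of_eq (by simp)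
    simp only [List.replicate_zero, List.nil_append]
    rw [show mem (false :: w) a o ρ τ .inp = false :: w from rfl, update_inp]
    exact runs_push_aux _
  | succ n ih =>
    refine (Runs.again (by simp [mem, List.replicate_succ]) ?_
      (ih (true :: a) (Function.update τ d (τ d + 1))) (m := 1 + 1)).of_eq ?_ |>.mono (by omega)
    · rw [show mem (List.replicate (n + 1) true ++ false :: w) a o ρ τ .inp =
        true :: (List.replicate n true ++ false :: w) from rfl, update_inp]
      exact (runs_push_aux _).seq (runs_push_tmp _)
    · rw [List.replicate_succ']
      simp only [Function.update_self, Function.update_idem, List.cons_append, List.append_assoc,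
        List.nil_append]
      congr 2
      omega

theorem runs_readNumber (B : List ℕ) (d : ℕ) (a o : List Bool) (ρ τ : ℕ → ℕ) {M : ℕ}
    (hM : (unary B).length ≤ M) :
    (readNumber d).Runs (mem (unary B) a o ρ τ)
      (mem (unary B.tail) ((unary (B.take 1)).reverse ++ a) o ρ
        (Function.update τ d (B.getD 0 0 + τ d))) (3 * M + 2) := by
  cases B with
  | nil =>
    refine ((Runs.exit (by simp [mem, unary]) (n := 1) (S' := mem (unary []) a o ρ τ) ?_).of_eq
      (by simp [unary])).mono (by omega)
    rw [show mem (unary []) a o ρ τ .inp = [] from rfl, update_inp]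
    exact Runs.skip _
  | cons n B =>
    simp only [unary_cons, List.length_append, List.length_replicate] at hM
    rw [unary_cons]
    refine ((runs_readNumber_aux n d (unary B) a o ρ τ).of_eq ?_).mono (by omega)
    simp [unary]

theorem runs_countNumbers (B : List ℕ) (d : ℕ) (a o : List Bool) (ρ τ : ℕ → ℕ) :
    (countNumbers d).Runs (mem (unary B) a o ρ τ)
      (mem [] ((unary B).reverse ++ a) o ρ (Function.update τ d (B.length + τ d)))
      (3 * (unary B).length + 2) := by
  induction B generalizing a τ with
  | nil =>
    refine ((Runs.exit (by simp [mem, unary]) (n := 1) (S' := mem (unary []) a o ρ τ) ?_).of_eq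
      (by simp [unary])).mono (by omega)
    rw [show mem (unary []) a o ρ τ .inp = [] from rfl, update_inp]
    exact Runs.skip _
  | cons n B ih =>
    rw [unary_cons]
    induction n generalizing a with
    | zero =>
      refine (Runs.again (by simp [mem]) ?_
        (ih (false :: a) (Function.update τ d (τ d + 1))) (m := 1 + 1)).of_eq ?_ |>.mono
          (by simp; omega)
      · simp only [List.replicate_zero, List.nil_append]
        rw [show mem (false :: unary B) a o ρ τ .inp = false :: unary B from rfl, update_inp]
        exact (runs_push_aux _).seq (runs_push_tmp _)
      · have h : B.length + (τ d + 1) = (0 :: B).length + τ d := by simp; omega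
        simp [h]
    | succ n ihn =>
      refine (Runs.again (by simp [mem, List.replicate_succ]) ?_ (ihn (true :: a))
        (m := 1)).of_eq ?_ |>.mono (by simp; omega)
      · rw [show mem (List.replicate (n + 1) true ++ false :: unary B) a o ρ τ .inp =
          true :: (List.replicate n true ++ false :: unary B) from rfl, update_inp]
        exact runs_push_aux _
      · rw [List.replicate_succ]; simp

/-- The correctness of the compilation of an expression: its value and the running time are bounded
by polynomials in the length of the input and the values of the variables. -/
def Computable (e : Expr) : Prop :=
  ∃ q p : Polynomial ℕ, ∀ (A : List ℕ) (ρ : ℕ → ℕ) (M : ℕ), (unary A).length ≤ M →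
    (∀ x, ρ x ≤ M) → e.eval A ρ ≤ q.eval M ∧
      ∀ (o : List Bool) (τ : ℕ → ℕ) (d : ℕ), (∀ j, d ≤ j → τ j = 0) →
        (e.compile d).Runs (mem (unary A) [] o ρ τ)
          (mem (unary A) [] o ρ (Function.update τ d (e.eval A ρ))) (p.eval M)

theorem computable_const (n : ℕ) : (const n).Computable := by
  refine ⟨.C n, .C (n + 1), fun A ρ M _ _ => ⟨by simp [eval], fun o τ d hτ => ?_⟩⟩
  simp only [compile, eval, Polynomial.eval_C]
  have h : ∀ (n : ℕ) (τ : ℕ → ℕ),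
      ((List.replicate n (Prog.push (Reg.tmp d) true)).foldr Prog.seq Prog.skip).Runs
      (mem (unary A) [] o ρ τ) (mem (unary A) [] o ρ (Function.update τ d (n + τ d))) (n + 1) := by
    intro n
    induction n with
    | zero => intro τ; exact (Runs.skip _).of_eq (by simp)
    | succ n ih =>
      intro τ
      refine (((runs_push_tmp d).seq (ih _)).of_eq ?_).mono (by omega)
      simp only [Function.update_self, Function.update_idem]
      congr 2
      omega
  simpa [hτ d le_rfl] using h n τ

theorem computable_var (x : ℕ) : (var x).Computable := by
  refine ⟨.X, 8 * .X + 4, fun A ρ M _ hρ => ⟨by simp [eval, hρ], fun o τ d hτ => ?_⟩⟩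
  refine ((runs_copy_var x d).of_eq ?_).mono (by simpa using hρ x)
  simp [eval, hτ d le_rfl]

theorem Computable.input {e : Expr} (h : e.Computable) : (input e).Computable := by
  obtain ⟨q, p, h⟩ := h
  refine ⟨.X, p + (q * (2 * .X + 3) + 2) + (3 * .X + 2) + (4 * .X + 2),
    fun A ρ M hA hρ => ⟨by simpa [eval] using (getD_le_length_unary _ _).trans hA,
      fun o τ d hτ => ?_⟩⟩
  obtain ⟨hq, hp⟩ := h A ρ M hA hρ
  set n := e.eval A ρ with hn
  have h1 := hp o τ d hτ
  have hun : ∀ j, (unary (A.drop j)).length ≤ M := fun j => by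
    refine le_trans ?_ hA
    conv_rhs => rw [← List.take_append_drop j A, unary_append]
    simp
  have h2 := runs_count (k := .tmp d) (body := skipNumber)
    (fun j => mem (unary (A.drop (n - j))) ((unary (A.take (n - j))).reverse) o ρ
      (Function.update τ d j)) n (2 * M + 2) (fun j => by simp [mem]) (fun j hj => by
        rw [update_tmp]
        refine (runs_skipNumber _ _ _ _ _ (hun _)).of_eq ?_
        rw [List.tail_drop, show n - (j + 1) + 1 = n - j by omega]
        congr 1
        · rw [← List.reverse_append, ← unary_append, ← List.take_add,
            show n - (j + 1) + 1 = n - j by omega]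
        · simp)
  simp only [Nat.sub_self, Nat.sub_zero, List.drop_zero, List.take_zero] at h2
  have h3 := runs_readNumber (A.drop n) d ((unary (A.take n)).reverse) o ρ (Function.update τ d 0)
    (hun n)
  have h4 := runs_move_aux_inp (i := unary (A.drop n).tail)
    (a := (unary ((A.drop n).take 1)).reverse ++ (unary (A.take n)).reverse) (o := o) (ρ := ρ)
    (τ := Function.update (Function.update τ d 0) d
      ((A.drop n).getD 0 0 + Function.update τ d 0 d))
  have hback : ((unary ((A.drop n).take 1)).reverse ++ (unary (A.take n)).reverse).reverse ++
      unary (A.drop n).tail = unary A := by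
    rw [List.reverse_append, List.reverse_reverse, List.reverse_reverse, List.append_assoc,
      ← unary_append, ← unary_append]
    congr 1
    conv_rhs => rw [← List.take_append_drop n A, ← List.take_append_drop 1 (A.drop n)]
    simp
  rw [hback] at h4
  refine ((h1.seq (h2.seq (h3.seq h4))).of_eq ?_).mono ?_
  · simp [eval, ← hn, List.getD_eq_getElem?_getD]
  · have hl : ((unary ((A.drop n).take 1)).reverse ++ (unary (A.take n)).reverse).length ≤ M := by
      refine le_trans ?_ hA
      rw [← hback]
      simp
      omega
    have : n * (2 * M + 2 + 1) ≤ q.eval M * (2 * M + 3) := Nat.mul_le_mul_right _ hq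
    simp only [Polynomial.eval_add, Polynomial.eval_mul, Polynomial.eval_ofNat, Polynomial.eval_X]
    omega

theorem computable_len : len.Computable := by
  refine ⟨.X, (3 * .X + 2) + (4 * .X + 2), fun A ρ M hA _ =>
    ⟨by simpa [eval] using (length_le_length_unary A).trans hA, fun o τ d hτ => ?_⟩⟩
  refine (((runs_countNumbers A d [] o ρ τ).seq runs_move_aux_inp).of_eq ?_).mono ?_
  · simp [eval, hτ d le_rfl]
  · simp
    omega

/-- The running time of a program that evaluates two expressions and goes on with `r`. -/
theorem runs_two {e f : Expr} {A : List ℕ} {ρ τ : ℕ → ℕ} {o : List Bool} {d m n l : ℕ}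
    {r : Prog Reg} {S : Reg → List Bool}
    (he : (e.compile d).Runs (mem (unary A) [] o ρ τ)
      (mem (unary A) [] o ρ (Function.update τ d (e.eval A ρ))) m)
    (hf : ∀ τ : ℕ → ℕ, (∀ j, d + 1 ≤ j → τ j = 0) → (f.compile (d + 1)).Runs
      (mem (unary A) [] o ρ τ) (mem (unary A) [] o ρ (Function.update τ (d + 1) (f.eval A ρ))) n)
    (hτ : ∀ j, d ≤ j → τ j = 0)
    (hr : r.Runs (mem (unary A) [] o ρ
      (Function.update (Function.update τ d (e.eval A ρ)) (d + 1) (f.eval A ρ))) S l) :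
    (Prog.seq (e.compile d) (.seq (f.compile (d + 1)) r)).Runs (mem (unary A) [] o ρ τ) S
      (m + (n + l)) := by
  refine he.seq ((hf _ fun j hj => ?_).seq hr)
  rw [Function.update_of_ne (by omega), hτ j (by omega)]

theorem Computable.add {e f : Expr} (he : e.Computable) (hf : f.Computable) :
    (add e f).Computable := by
  obtain ⟨q₁, p₁, he⟩ := he
  obtain ⟨q₂, p₂, hf⟩ := hf
  refine ⟨q₁ + q₂, p₁ + (p₂ + (4 * q₂ + 2)), fun A ρ M hA hρ => ?_⟩
  obtain ⟨hq₁, hp₁⟩ := he A ρ M hA hρ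
  obtain ⟨hq₂, hp₂⟩ := hf A ρ M hA hρ
  refine ⟨by simp [eval]; omega, fun o τ d hτ => ?_⟩
  refine ((runs_two (hp₁ o τ d hτ) (fun τ hτ => hp₂ o τ (d + 1) hτ) hτ
    (runs_move_tmp_tmp (by omega))).of_eq ?_).mono ?_
  · congr 1
    funext j
    have := hτ (d + 1) (by omega)
    simp only [Function.update_apply, eval]
    split_ifs <;> grind
  · simp
    omega

theorem Computable.sub {e f : Expr} (he : e.Computable) (hf : f.Computable) :
    (sub e f).Computable := by
  obtain ⟨q₁, p₁, he⟩ := he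
  obtain ⟨q₂, p₂, hf⟩ := hf
  refine ⟨q₁, p₁ + (p₂ + (q₂ * 3 + 2)), fun A ρ M hA hρ => ?_⟩
  obtain ⟨hq₁, hp₁⟩ := he A ρ M hA hρ
  obtain ⟨hq₂, hp₂⟩ := hf A ρ M hA hρ
  refine ⟨by simp [eval]; omega, fun o τ d hτ => ?_⟩
  have h := runs_count (k := .tmp (d + 1)) (body := .pop (.tmp d) (fun _ => .skip) fun _ => false)
    (fun j => mem (unary A) [] o ρ (Function.update (Function.update τ d
      (e.eval A ρ - (f.eval A ρ - j))) (d + 1) j)) (f.eval A ρ) 2 (fun j => by simp [mem])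
    (fun j hj => by
      refine (Runs.exit rfl (Runs.skip _) : Runs _ _ _ (1 + 1)).of_eq ?_
      rw [update_tmp]
      have : (mem (unary A) [] o ρ (Function.update (Function.update (Function.update τ d
          (e.eval A ρ - (f.eval A ρ - (j + 1)))) (d + 1) (j + 1)) (d + 1) j) (.tmp d)).tail =
          List.replicate (e.eval A ρ - (f.eval A ρ - (j + 1)) - 1) true := by
        simp [mem]
      rw [this, update_tmp]
      congr 1
      funext i
      simp only [Function.update_apply]
      split_ifs <;> omega)
  simp only [Nat.sub_self, Nat.sub_zero] at h
  refine ((runs_two (hp₁ o τ d hτ) (fun τ hτ => hp₂ o τ (d + 1) hτ) hτ h).of_eq ?_).mono ?_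
  · congr 1
    funext j
    have := hτ (d + 1) (by omega)
    simp only [Function.update_apply, eval]
    split_ifs <;> grind
  · simp
    omega

theorem Computable.mul {e f : Expr} (he : e.Computable) (hf : f.Computable) :
    (mul e f).Computable := by
  obtain ⟨q₁, p₁, he⟩ := he
  obtain ⟨q₂, p₂, hf⟩ := hf
  refine ⟨q₁ * q₂, p₁ + (p₂ + ((q₁ * (8 * q₂ + 5) + 2) + ((4 * q₂ + 2) + (4 * (q₁ * q₂) + 2)))),
    fun A ρ M hA hρ => ?_⟩
  obtain ⟨hq₁, hp₁⟩ := he A ρ M hA hρ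
  obtain ⟨hq₂, hp₂⟩ := hf A ρ M hA hρ
  have hq : e.eval A ρ * f.eval A ρ ≤ q₁.eval M * q₂.eval M := Nat.mul_le_mul hq₁ hq₂
  refine ⟨by simpa [eval] using hq, fun o τ d hτ => ?_⟩
  have h := runs_count (k := .tmp d)
    (body := (.seq (.move (.tmp (d + 1)) [.aux, .tmp (d + 2)]) (.move .aux [.tmp (d + 1)])))
    (fun j => mem (unary A) [] o ρ (Function.update (Function.update (Function.update τ d j)
      (d + 1) (f.eval A ρ)) (d + 2) ((e.eval A ρ - j) * f.eval A ρ)))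
      (e.eval A ρ) (8 * f.eval A ρ + 4) (fun j => by simp [mem])
    (fun j hj => by
      rw [update_tmp]
      refine ((runs_copy_tmp (by omega)).of_eq ?_).mono ?_
      · congr 1
        funext i
        have : (e.eval A ρ - j) * f.eval A ρ =
            f.eval A ρ + (e.eval A ρ - (j + 1)) * f.eval A ρ := by
          rw [show e.eval A ρ - j = (e.eval A ρ - (j + 1)) + 1 by omega]
          ring
        simp only [Function.update_apply]
        split_ifs <;> grind
      · simp)
  simp only [Nat.sub_self, Nat.sub_zero, Nat.zero_mul] at h
  have h0 : Function.update (Function.update (Function.update τ d (e.eval A ρ)) (d + 1)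
      (f.eval A ρ)) (d + 2) 0 =
      Function.update (Function.update τ d (e.eval A ρ)) (d + 1) (f.eval A ρ) := by
    rw [Function.update_eq_self_iff]
    simp [hτ (d + 2)]
  rw [h0] at h
  refine ((runs_two (hp₁ o τ d hτ) (fun τ hτ => hp₂ o τ (d + 1) hτ) hτ
    (h.seq ((runs_clear_tmp (d + 1)).seq (runs_move_tmp_tmp (by omega))))).of_eq ?_).mono ?_
  · congr 1
    funext j
    have h1 := hτ (d + 1) (by omega)
    have h2 := hτ (d + 2) (by omega)
    simp only [Function.update_apply, eval]
    split_ifs <;> grind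
  · have : e.eval A ρ * (8 * f.eval A ρ + 4 + 1) ≤ q₁.eval M * (8 * q₂.eval M + 5) :=
      Nat.mul_le_mul hq₁ (by omega)
    simp
    omega

theorem Computable.ifPos {c e f : Expr} (hc : c.Computable) (he : e.Computable)
    (hf : f.Computable) : (ifPos c e f).Computable := by
  obtain ⟨q₀, p₀, hc⟩ := hc
  obtain ⟨q₁, p₁, he⟩ := he
  obtain ⟨q₂, p₂, hf⟩ := hf
  refine ⟨q₁ + q₂, p₀ + ((4 * q₀ + 2) + p₁ + p₂ + 1), fun A ρ M hA hρ => ?_⟩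
  obtain ⟨hq₀, hp₀⟩ := hc A ρ M hA hρ
  obtain ⟨hq₁, hp₁⟩ := he A ρ M hA hρ
  obtain ⟨hq₂, hp₂⟩ := hf A ρ M hA hρ
  refine ⟨by simp only [eval]; split_ifs <;> simp <;> omega, fun o τ d hτ => ?_⟩
  have hτ' : Function.update τ d 0 = τ := by
    rw [Function.update_eq_self_iff, hτ d le_rfl]
  refine ((hp₀ o τ d hτ).seq (n := (4 * q₀ + 2).eval M + p₁.eval M + p₂.eval M + 1) ?_).mono
    (by simp)
  refine Runs.exit rfl ?_
  rcases Nat.eq_zero_or_pos (c.eval A ρ) with h0 | h0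
  · have h1 : mem (unary A) [] o ρ (Function.update τ d (c.eval A ρ)) (.tmp d) = [] := by
      simp [mem, h0]
    rw [h1, show ([] : List Bool).tail = List.replicate 0 true from rfl, update_tmp]
    simp only [Function.update_idem, hτ', List.head?_nil]
    refine ((hp₂ o τ d hτ).of_eq ?_).mono (by omega)
    simp [eval, h0]
  · obtain ⟨n, hn⟩ : ∃ n, c.eval A ρ = n + 1 := ⟨c.eval A ρ - 1, by omega⟩
    have h1 : mem (unary A) [] o ρ (Function.update τ d (c.eval A ρ)) (.tmp d) =
        true :: List.replicate n true := by
      simp [mem, hn, List.replicate_succ]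
    rw [h1, List.tail_cons, update_tmp]
    simp only [Function.update_idem, List.head?_cons]
    have h2 := runs_clear_tmp (i := unary A) (a := []) (o := o) (ρ := ρ)
      (τ := Function.update τ d n) d
    simp only [Function.update_idem, Function.update_self, hτ'] at h2
    refine ((h2.seq (hp₁ o τ d hτ)).of_eq ?_).mono (by simp; omega)
    simp [eval, h0]

/-- The execution of a loop over all values of a variable `x` less than the value `n` of the counter
`tmp d`, in descending order. -/
theorem runs_for {i : List Bool} {ρ τ : ℕ → ℕ} {o : List Bool} {d n t M x : ℕ}
    {body : Prog Reg} (v : ℕ → ℕ) (w : ℕ → List Bool) (ho : w n = o) (hv : v n = 0)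
    (hτ : ∀ j, d ≤ j → τ j = 0) (hρ : ρ x ≤ M)
    (hb : ∀ j < n, body.Runs
      (mem i [] (w (j + 1)) (Function.update ρ x j)
        (Function.update (Function.update τ (d + 1) (ρ x)) d (v (j + 1))))
      (mem i [] (w j) (Function.update ρ x j)
        (Function.update (Function.update τ (d + 1) (ρ x)) d (v j))) t) :
    (Prog.seq (.move (.var x) [.tmp (d + 1)]) <| .seq (.move (.tmp d) [.var x]) <|
      .seq (.count (.var x) body) (.move (.tmp (d + 1)) [.var x])).Runs
      (mem i [] o ρ (Function.update τ d n)) (mem i [] (w 0) ρ (Function.update τ d (v 0)))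
      ((4 * M + 2) + ((4 * n + 2) + ((n * (t + 1) + 2) + (4 * M + 2)))) := by
  have h := runs_count (k := .var x) (body := body)
    (fun j => mem i [] (w j) (Function.update ρ x j)
      (Function.update (Function.update τ (d + 1) (ρ x)) d (v j))) n t
    (fun j => by simp [mem]) (fun j hj => by
      rw [update_var]
      simpa using hb j hj)
  have h1 : (Prog.move (.tmp d) [.var x]).Runs
      (mem i [] o (Function.update ρ x 0) (Function.update (Function.update τ d n) (d + 1)
        (ρ x + Function.update τ d n (d + 1)))) (mem i [] (w n) (Function.update ρ x n)
        (Function.update (Function.update τ (d + 1) (ρ x)) d (v n))) (4 * n + 2) := by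
    refine ((runs_move_tmp_var d x).of_eq ?_).mono (by simp)
    rw [ho, hv]
    have h1 := hτ (d + 1) (by omega)
    congr 1
    · funext j
      simp only [Function.update_apply]
      split_ifs <;> grind
    · funext j
      simp only [Function.update_apply]
      split_ifs <;> grind
  refine (((runs_move_var_tmp x (d + 1)).mono (by omega)).seq (h1.seq (h.seq
    ((runs_move_tmp_var (d + 1) x).mono ?_)))).of_eq ?_
  · simp [hρ]
  · have h1 := hτ (d + 1) (by omega)
    congr 1
    · funext j
      simp only [Function.update_apply]
      split_ifs <;> grind
    · funext j
      simp only [Function.update_apply]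
      split_ifs <;> grind

theorem Computable.sum {e f : Expr} (x : ℕ) (he : e.Computable) (hf : f.Computable) :
    (sum x e f).Computable := by
  obtain ⟨q₁, p₁, he⟩ := he
  obtain ⟨q₂, p₂, hf⟩ := hf
  -- The values of the bound variable are bounded by those of `q₁`.
  set q : Polynomial ℕ := q₂.comp (.X + q₁) with hq
  set p : Polynomial ℕ := p₂.comp (.X + q₁) with hp
  refine ⟨q₁ * q, p₁ + ((4 * .X + 2) + ((4 * q₁ + 2) + ((q₁ * (p + (4 * q + 2) + 1) + 2) +
    (4 * .X + 2)))), fun A ρ M hA hρ => ?_⟩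
  obtain ⟨hq₁, hp₁⟩ := he A ρ M hA hρ
  have hf' : ∀ j < e.eval A ρ, _ := fun j hj =>
    hf A (Function.update ρ x j) (M + q₁.eval M) (by omega) (fun y => by
      rw [Function.update_apply]
      split_ifs
      · omega
      · exact (hρ y).trans (by omega))
  have hqM : q.eval M = q₂.eval (M + q₁.eval M) := by simp [hq]
  have hpM : p.eval M = p₂.eval (M + q₁.eval M) := by simp [hp]
  simp only [← hqM, ← hpM] at hf'
  refine ⟨?_, fun o τ d hτ => ?_⟩
  · simp only [eval, Polynomial.eval_mul]
    refine (Finset.sum_le_card_nsmul _ _ (q.eval M) fun j hj => ?_).trans ?_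
    · exact (hf' j (Finset.mem_range.1 hj)).1
    · simpa using Nat.mul_le_mul_right _ hq₁
  · set n := e.eval A ρ with hn
    have h := runs_for (i := unary A) (ρ := ρ) (τ := τ) (o := o) (d := d) (n := n)
      (t := p.eval M + (4 * q.eval M + 2)) (M := M) (x := x)
      (body := .seq (f.compile (d + 2)) (.move (.tmp (d + 2)) [.tmp d]))
      (fun j => ∑ i ∈ Finset.Ico j n, f.eval A (Function.update ρ x i)) (fun _ => o) rfl (by simp)
      hτ (hρ x) (fun j hj => by
        obtain ⟨hqj, hpj⟩ := hf' j hj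
        refine (((hpj o _ (d + 2) fun k hk => ?_).seq
          (runs_move_tmp_tmp (by omega))).of_eq ?_).mono ?_
        · rw [Function.update_of_ne (by omega), Function.update_of_ne (by omega), hτ k (by omega)]
        · rw [Finset.sum_eq_sum_Ico_succ_bot hj]
          have h1 := hτ (d + 2) (by omega)
          congr 1
          funext k
          simp only [Function.update_apply]
          split_ifs <;> grind
        · simp
          omega)
    refine (((hp₁ o τ d hτ).seq h).of_eq ?_).mono ?_
    · simp [eval, hn]
    · have := Nat.mul_le_mul_right (p.eval M + (4 * q.eval M + 2) + 1) hq₁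
      simp
      omega

theorem computable (e : Expr) : e.Computable := by
  induction e with
  | const n => exact computable_const n
  | var x => exact computable_var x
  | input e he => exact he.input
  | len => exact computable_len
  | add e f he hf => exact he.add hf
  | mul e f he hf => exact he.mul hf
  | sub e f he hf => exact he.sub hf
  | ifPos c e f hc he hf => exact hc.ifPos he hf
  | sum x e f he hf => exact he.sum x hf

end Expr

/-- Programs that write a list of natural numbers. -/
inductive Emit
  /-- write the value of an expression -/
  | emit (e : Expr)
  | seq (P Q : Emit)
  /-- execute `P` for all values less than `e` of the variable `x` -/
  | loop (x : ℕ) (e : Expr) (P : Emit)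

namespace Emit

/-- The list that a program writes. -/
def eval (A : List ℕ) : Emit → (ℕ → ℕ) → List ℕ
  | emit e, ρ => [e.eval A ρ]
  | seq P Q, ρ => P.eval A ρ ++ Q.eval A ρ
  | loop x e P, ρ => (List.range (e.eval A ρ)).flatMap fun i => P.eval A (Function.update ρ x i)

/-- The program that pushes the list on the output stack. As a stack is filled from its end,
everything is done in reverse order. -/
def compile : Emit → ℕ → Prog Reg
  | emit e, d => .seq (.push .out false) (.seq (e.compile d) (.move (.tmp d) [.out]))
  | seq P Q, d => .seq (Q.compile d) (P.compile d)
  | loop x e P, d => .seq (e.compile d) <| .seq (.move (.var x) [.tmp (d + 1)]) <|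
      .seq (.move (.tmp d) [.var x]) <|
      .seq (.count (.var x) (P.compile (d + 2))) <| .move (.tmp (d + 1)) [.var x]

theorem runs_compile (P : Emit) : ∃ p : Polynomial ℕ, ∀ (A : List ℕ) (ρ : ℕ → ℕ) (M : ℕ),
    (unary A).length ≤ M → (∀ x, ρ x ≤ M) →
      ∀ (o : List Bool) (τ : ℕ → ℕ) (d : ℕ), (∀ j, d ≤ j → τ j = 0) →
        (P.compile d).Runs (mem (unary A) [] o ρ τ)
          (mem (unary A) [] (unary (P.eval A ρ) ++ o) ρ τ) (p.eval M) := by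
  induction P with
  | emit e =>
    obtain ⟨q, p, h⟩ := e.computable
    refine ⟨1 + (p + (4 * q + 2)), fun A ρ M hA hρ o τ d hτ => ?_⟩
    obtain ⟨hq, hp⟩ := h A ρ M hA hρ
    have hτ' : Function.update τ d 0 = τ := by
      rw [Function.update_eq_self_iff, hτ d le_rfl]
    refine (((runs_push_out false).seq ((hp _ τ d hτ).seq (runs_move_tmp_out d))).of_eq ?_).mono ?_
    · simp [eval, unary, hτ']
    · simp
      omega
  | seq P Q hP hQ =>
    obtain ⟨p₁, hP⟩ := hP
    obtain ⟨p₂, hQ⟩ := hQ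
    refine ⟨p₂ + p₁, fun A ρ M hA hρ o τ d hτ => ?_⟩
    refine (((hQ A ρ M hA hρ o τ d hτ).seq (hP A ρ M hA hρ _ τ d hτ)).of_eq ?_).mono (by simp)
    simp [eval, unary_append]
  | loop x e P hP =>
    obtain ⟨q₁, p₁, he⟩ := e.computable
    obtain ⟨p₂, hP⟩ := hP
    set p : Polynomial ℕ := p₂.comp (.X + q₁) with hp
    refine ⟨p₁ + ((4 * .X + 2) + ((4 * q₁ + 2) + ((q₁ * (p + 1) + 2) + (4 * .X + 2)))),
      fun A ρ M hA hρ o τ d hτ => ?_⟩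
    obtain ⟨hq₁, hp₁⟩ := he A ρ M hA hρ
    have hpM : p.eval M = p₂.eval (M + q₁.eval M) := by simp [hp]
    set n := e.eval A ρ with hn
    have hP' : ∀ j < n, _ := fun j hj =>
      hP A (Function.update ρ x j) (M + q₁.eval M) (by omega) (fun y => by
        rw [Function.update_apply]
        split_ifs
        · omega
        · exact (hρ y).trans (by omega))
    simp only [← hpM] at hP'
    have h := Expr.runs_for (i := unary A) (ρ := ρ) (τ := τ) (o := o) (d := d) (n := n)
      (t := p.eval M) (M := M) (x := x) (body := P.compile (d + 2)) (fun _ => 0)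
      (fun j => unary ((List.range' j (n - j)).flatMap fun i =>
        P.eval A (Function.update ρ x i)) ++ o) (by simp [unary]) rfl
      hτ (hρ x) (fun j hj => by
        refine (hP' j hj _ _ (d + 2) fun k hk => ?_).of_eq ?_
        · rw [Function.update_of_ne (by omega), Function.update_of_ne (by omega), hτ k (by omega)]
        · rw [show n - j = (n - (j + 1)) + 1 by omega, List.range'_succ, List.flatMap_cons,
            unary_append, List.append_assoc])
    have hτ' : Function.update τ d 0 = τ := by
      rw [Function.update_eq_self_iff, hτ d le_rfl]
    refine (((hp₁ o τ d hτ).seq h).of_eq ?_).mono ?_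
    · simp [eval, hn, hτ', List.range_eq_range']
    · have := Nat.mul_le_mul_right (p.eval M + 1) hq₁
      simp
      omega

/-- A function is computable in polynomial time if a program maps the code of the argument to the
code of the value. -/
theorem computableInPolyTime (P : Emit) {X Y : Type} (cX : X → List ℕ) (cY : Y → List ℕ) (F : X → Y)
    (h : ∀ x, P.eval (cX x) 0 = cY (F x)) :
    Nonempty (TM2ComputableInPolyTime (fun x => unary (cX x)) (fun y => unary (cY y)) F) := by
  obtain ⟨p, hp⟩ := P.runs_compile
  refine Prog.computableInPolyTime (.seq (P.compile 0) (.move .inp [])) .inp .out _ _ F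
    (p + (4 * .X + 2)) fun x => ?_
  have h0 : ∀ w, Function.update (fun _ => []) Reg.inp w = mem w [] [] 0 0 := fun w => by
    funext r
    cases r <;> simp [mem]
  have h1 : ∀ w, Function.update (fun _ => []) Reg.out w = mem [] [] w 0 0 := fun w => by
    funext r
    cases r <;> simp [mem]
  rw [h0, h1]
  refine (((hp (cX x) 0 _ le_rfl (by simp) [] 0 0 (by simp)).seq runs_clear_inp).of_eq ?_).mono
    (by simp)
  simp [h]

end Emit

end BiddingGames

/-! ### Games in which every move is replaced by two moves -/

namespace BiddingGames

/-- Player 1 can force the next vertex to be in `S`. -/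
def ConcurrentArena.Forces {A V : Type} (G : ConcurrentArena A V) (v : V) (S : Set V) : Prop :=
  ∃ a ∈ G.allowed v .one, ∀ b ∈ G.allowed v .two, G.next v a b ∈ S

theorem ConcurrentArena.Forces.mono {A V : Type} {G : ConcurrentArena A V} {v : V} {S T : Set V}
    (h : G.Forces v S) (hST : S ⊆ T) : G.Forces v T :=
  let ⟨a, ha, h⟩ := h
  ⟨a, ha, fun b hb => hST (h b hb)⟩

theorem ConcurrentArena.forces_univ {A V : Type} (G : ConcurrentArena A V) (v : V) :
    G.Forces v Set.univ :=
  let ⟨a, ha⟩ := G.allowed_nonempty v .one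
  ⟨a, ha, fun _ _ => trivial⟩

/-- Player 1 wins a game in which he, in a vertex `v`, repeatedly chooses a set that satisfies `F v`
and his opponent an element of this set as the next vertex, with a strategy that uses a memory. -/
def ForcingWins {V : Type} (F : V → Set V → Prop) (Obj : Set (ℕ → V)) (v : V) : Prop :=
  ∃ (M : Type) (m₀ : M) (act : M → V → Set V) (upd : M → V → V → M), (∀ m v, F v (act m v)) ∧
    ∀ (ms : ℕ → M) (vs : ℕ → V), ms 0 = m₀ → vs 0 = v →
      (∀ n, vs (n + 1) ∈ act (ms n) (vs n)) →
      (∀ n, ms (n + 1) = upd (ms n) (vs n) (vs (n + 1))) → vs ∈ Obj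

/-- As a strategy of Player 1 has to win against all strategies of Player 2, only the sets of
vertices that Player 1 can force matter. -/
theorem ConcurrentArena.playerOneWins_iff {A V : Type} (G : ConcurrentArena A V)
    (Obj : Set (ℕ → V)) (v : V) : G.PlayerOneWins Obj v ↔ ForcingWins G.Forces Obj v := by
  classical
  constructor
  · rintro ⟨σ₁, hσ₁, hwin⟩
    -- The memory is the history; the actions of Player 2 are guessed from the vertices.
    let reply : List (V × A × A) → V → V → A := fun h v u =>
      if hb : ∃ b ∈ G.allowed v .two, u = G.next v (σ₁ h v) b then hb.choose else σ₁ h v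
    have hreply : ∀ h v u, (∃ b ∈ G.allowed v .two, u = G.next v (σ₁ h v) b) →
        reply h v u ∈ G.allowed v .two ∧ u = G.next v (σ₁ h v) (reply h v u) := by
      intro h v u hb
      simp only [reply, dif_pos hb]
      exact hb.choose_spec
    refine ⟨List (V × A × A), [], fun h v => {u | ∃ b ∈ G.allowed v .two, u = G.next v (σ₁ h v) b},
      fun h v u => h ++ [(v, σ₁ h v, reply h v u)],
      fun h v => ⟨σ₁ h v, hσ₁ h v, fun b hb => ⟨b, hb, rfl⟩⟩, fun hs vs h0 v0 hvs hhs => ?_⟩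
    let bs : ℕ → A := fun n => reply (hs n) (vs n) (vs (n + 1))
    let σ₂ : Strategy A V := fun h v =>
      if bs h.length ∈ G.allowed v .two then bs h.length else (G.allowed_nonempty v .two).choose
    have hσ₂ : G.IsLegal .two σ₂ := by
      intro h v
      simp only [σ₂]
      split_ifs with hb
      · exact hb
      · exact (G.allowed_nonempty v .two).choose_spec
    have hlen : ∀ n, (hs n).length = n := by
      intro n
      induction n with
      | zero => simp [h0]
      | succ n ih => simp [hhs, ih]
    have key : ∀ n, G.history σ₁ σ₂ v n = (hs n, vs n) := by
      intro n
      induction n with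
      | zero => simp [history, h0, v0]
      | succ n ih =>
        obtain ⟨hb, hv⟩ := hreply _ _ _ (hvs n)
        have hσ : σ₂ (hs n) (vs n) = reply (hs n) (vs n) (vs (n + 1)) := by
          simp only [σ₂, hlen, bs]
          exact if_pos hb
        simp only [history, ih, hσ]
        rw [hhs n, ← hv]
    have hpath : G.path σ₁ σ₂ v = vs := funext fun n => by simp [path, key]
    exact hpath ▸ hwin σ₂ hσ₂
  · rintro ⟨M, m₀, act, upd, hact, hwin⟩
    choose σ hσ hσ' using hact
    -- The memory is a function of the history, so a strategy can use it.
    let memory : List (V × A × A) → M :=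
      List.foldl (fun m t => upd m t.1 (G.next t.1 t.2.1 t.2.2)) m₀
    refine ⟨fun h v => σ (memory h) v, fun h v => hσ _ v, fun σ₂ hσ₂ => ?_⟩
    refine hwin (fun n => memory (G.history (fun h v => σ (memory h) v) σ₂ v n).1) _ rfl rfl
      (fun n => ?_) fun n => ?_
    · exact hσ' _ _ _ (hσ₂ _ _)
    · simp [history, path, memory]

/-- Whether a play is winning is not affected if every vertex is repeated. -/
theorem QualitativeObjective.winningPaths_double (α : QualitativeObjective) {V W : Type}
    {d : α.Data} {col : V → Fin (α.numColours d)} {col' : W → Fin (α.numColours d)} {vs : ℕ → V}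
    {ws : ℕ → W} (h0 : ∀ n, col' (ws (2 * n)) = col (vs n))
    (h1 : ∀ n, col' (ws (2 * n + 1)) = col (vs n)) :
    ws ∈ α.winningPaths d col' ↔ vs ∈ α.winningPaths d col := by
  have key : ∀ m, col' (ws m) = col (vs (m / 2)) := by
    intro m
    rcases Nat.even_or_odd' m with ⟨k, rfl | rfl⟩
    · rw [h0]; congr 2; omega
    · rw [h1]; congr 2; omega
  have hvis : {c | ∃ n, col' (ws n) = c} = {c | ∃ n, col (vs n) = c} := by
    ext c
    constructor
    · rintro ⟨n, rfl⟩; exact ⟨n / 2, (key n).symm⟩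
    · rintro ⟨n, rfl⟩; exact ⟨2 * n, h0 n⟩
  have hinf : {c | ∃ᶠ n in Filter.atTop, col' (ws n) = c} =
      {c | ∃ᶠ n in Filter.atTop, col (vs n) = c} := by
    ext c
    simp only [Set.mem_ofPred_eq, Filter.frequently_atTop]
    constructor
    · intro h n
      obtain ⟨m, hm, rfl⟩ := h (2 * n)
      exact ⟨m / 2, by omega, (key m).symm⟩
    · intro h n
      obtain ⟨m, hm, rfl⟩ := h n
      exact ⟨2 * m, by omega, h0 m⟩
  simp only [winningPaths, Set.mem_ofPred_eq, hvis, hinf]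

/-- If a move of the game `G` corresponds to two moves of the game `H`, the first of which does not
change the colour, then the two games have the same winner. -/
theorem playerOneWins_double (α : QualitativeObjective) {A B V W : Type} {d : α.Data}
    (G : ConcurrentArena A V) (H : ConcurrentArena B W) (e : V → W)
    (col : V → Fin (α.numColours d)) (col' : W → Fin (α.numColours d))
    (hcol : ∀ v, col' (e v) = col v) (hnext : ∀ v a b, col' (H.next (e v) a b) = col v)
    (hGH : ∀ v S, G.Forces v S → H.Forces (e v) {w | H.Forces w (e '' S)})
    (hHG : ∀ v T, H.Forces (e v) {w | H.Forces w T} → ∃ S, G.Forces v S ∧ e '' S ⊆ T) (v : V) :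
    G.PlayerOneWins (α.winningPaths d col) v ↔ H.PlayerOneWins (α.winningPaths d col') (e v) := by
  classical
  have hmid : ∀ v T, H.Forces (e v) T → H.Forces (e v) {w ∈ T | col' w = col v} :=
    fun v T ⟨a, ha, h⟩ => ⟨a, ha, fun b hb => ⟨h b hb, hnext v a b⟩⟩
  rw [G.playerOneWins_iff, H.playerOneWins_iff]
  constructor
  · rintro ⟨M, m₀, act, upd, hact, hwin⟩
    -- The memory consists of that of the given strategy, the vertex of `G`, and a bit that tells
    -- whether half of a move of `G` has been made.
    let first : M × V → Set W := fun m =>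
      {w ∈ {w | H.Forces w (e '' act m.1 m.2)} | col' w = col m.2}
    let second : M × V → Set W := fun m => e '' act m.1 m.2
    let goal : (M × V) × Bool → Set W := fun m => if m.2 then second m.1 else first m.1
    let nextVertex : M × V → W → V := fun m w =>
      if h : ∃ u ∈ act m.1 m.2, e u = w then h.choose else m.2
    have hnextVertex : ∀ m w, w ∈ second m →
        nextVertex m w ∈ act m.1 m.2 ∧ e (nextVertex m w) = w := by
      intro m w hw
      have h : ∃ u ∈ act m.1 m.2, e u = w := hw
      simp only [nextVertex, dif_pos h]
      exact h.choose_spec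
    refine ⟨(M × V) × Bool, ((m₀, v), false),
      fun m w => if H.Forces w (goal m) then goal m else Set.univ,
      fun m _ w' => if m.2 then
        ((upd m.1.1 m.1.2 (nextVertex m.1 w'), nextVertex m.1 w'), false) else (m.1, true),
      fun m w => ?_, fun ms ws hm₀ hw₀ hws hms => ?_⟩
    · dsimp only
      split_ifs with h
      exacts [h, H.forces_univ w]
    · have step : ∀ n, (ms (2 * n)).2 = false → ws (2 * n) = e (ms (2 * n)).1.2 →
          col' (ws (2 * n + 1)) = col (ms (2 * n)).1.2 ∧
          ms (2 * (n + 1)) = ((upd (ms (2 * n)).1.1 (ms (2 * n)).1.2 (ms (2 * (n + 1))).1.2,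
            (ms (2 * (n + 1))).1.2), false) ∧
          (ms (2 * (n + 1))).1.2 ∈ act (ms (2 * n)).1.1 (ms (2 * n)).1.2 ∧
          ws (2 * (n + 1)) = e (ms (2 * (n + 1))).1.2 := by
        intro n hph hw
        have h1 := hws (2 * n)
        have hm1 := hms (2 * n)
        simp only [hph, goal, Bool.false_eq_true, if_false] at h1 hm1
        rw [if_pos (by rw [hw]; exact hmid _ _ (hGH _ _ (hact _ _)))] at h1
        have h2 := hws (2 * n + 1)
        have hm2 := hms (2 * n + 1)
        rw [hm1] at h2 hm2
        simp only [goal, if_true] at h2 hm2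
        rw [if_pos (show H.Forces _ (second _) from h1.1)] at h2
        obtain ⟨h3, h4⟩ := hnextVertex _ _ h2
        rw [show 2 * (n + 1) = 2 * n + 1 + 1 by ring, hm2]
        exact ⟨h1.2, rfl, h3, h4.symm⟩
      have inv : ∀ n, (ms (2 * n)).2 = false ∧ ws (2 * n) = e (ms (2 * n)).1.2 := by
        intro n
        induction n with
        | zero => simp [hm₀, hw₀]
        | succ n ih =>
          obtain ⟨-, h1, -, h2⟩ := step n ih.1 ih.2
          exact ⟨by rw [h1], h2⟩
      have step' := fun n => step n (inv n).1 (inv n).2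
      rw [α.winningPaths_double (col := col) (vs := fun n => (ms (2 * n)).1.2)
        (fun n => by rw [(inv n).2, hcol]) (fun n => (step' n).1)]
      refine hwin (fun n => (ms (2 * n)).1.1) _ (by simp [hm₀]) (by simp [hm₀])
        (fun n => (step' n).2.2.1) fun n => ?_
      have := (step' n).2.1
      exact congrArg (fun m => m.1.1) this
  · rintro ⟨M, m₀, act, upd, hact, hwin⟩
    -- The vertices that can be reached in two moves under the given strategy.
    let reach : M → V → Set W := fun m v =>
      {w' | ∃ w ∈ act m (e v), col' w = col v ∧ w' ∈ act (upd m (e v) w) w}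
    have hreach : ∀ m v, ∃ S, G.Forces v S ∧ e '' S ⊆ reach m v := by
      intro m v
      refine hHG v _ ((hmid v _ (hact m (e v))).mono ?_)
      rintro w ⟨hw, hc⟩
      exact (hact (upd m (e v) w) w).mono fun w' hw' => ⟨w, hw, hc, hw'⟩
    choose S hS hSr using hreach
    let mid : M → V → V → W := fun m v u =>
      if h : e u ∈ reach m v then h.choose else e u
    have hmid' : ∀ m v u, u ∈ S m v → mid m v u ∈ act m (e v) ∧ col' (mid m v u) = col v ∧
        e u ∈ act (upd m (e v) (mid m v u)) (mid m v u) := by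
      intro m v u hu
      have h : e u ∈ reach m v := hSr m v ⟨u, hu, rfl⟩
      simp only [mid, dif_pos h]
      exact h.choose_spec
    refine ⟨M, m₀, S, fun m v u => upd (upd m (e v) (mid m v u)) (mid m v u) (e u), hS,
      fun ms vs hm₀ hv₀ hvs hms => ?_⟩
    have h := fun n => hmid' _ _ _ (hvs n)
    let ws : ℕ → W := fun n =>
      if n % 2 = 0 then e (vs (n / 2)) else mid (ms (n / 2)) (vs (n / 2)) (vs (n / 2 + 1))
    let ns : ℕ → M := fun n => if n % 2 = 0 then ms (n / 2) else
      upd (ms (n / 2)) (e (vs (n / 2))) (mid (ms (n / 2)) (vs (n / 2)) (vs (n / 2 + 1)))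
    have hw0 : ∀ n, ws (2 * n) = e (vs n) := fun n => by simp [ws]
    have hw1 : ∀ n, ws (2 * n + 1) = mid (ms n) (vs n) (vs (n + 1)) := fun n => by
      have : (2 * n + 1) / 2 = n := by omega
      simp [ws, this]
    have hn0 : ∀ n, ns (2 * n) = ms n := fun n => by simp [ns]
    have hn1 : ∀ n, ns (2 * n + 1) = upd (ms n) (e (vs n)) (mid (ms n) (vs n) (vs (n + 1))) :=
      fun n => by
        have : (2 * n + 1) / 2 = n := by omega
        simp [ns, this]
    rw [← α.winningPaths_double (col' := col') (ws := ws) (fun n => by rw [hw0, hcol])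
      (fun n => by rw [hw1, (h n).2.1])]
    refine hwin ns ws (by simpa [hm₀] using hn0 0) (by simpa [hv₀] using hw0 0) (fun n => ?_)
      fun n => ?_
    · rcases Nat.even_or_odd' n with ⟨k, rfl | rfl⟩
      · rw [hw1, hn0, hw0]; exact (h k).1
      · rw [show 2 * k + 1 + 1 = 2 * (k + 1) by ring, hw0, hn1, hw1]; exact (h k).2.2
    · rcases Nat.even_or_odd' n with ⟨k, rfl | rfl⟩
      · rw [hw1, hn0, hw0, hn1]
      · rw [show 2 * k + 1 + 1 = 2 * (k + 1) by ring, hw0, hn1, hw1, hn0, hms k]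

end BiddingGames

/-! ### From turn-based games to bidding games -/

namespace BiddingGames

theorem BiddingArena.token_next_config {V Q : Type} {N : ℕ} (G : BiddingArena V Q N)
    (c : Config V Q N) (a b : Action V N) :
    (G.concurrent.next (.config c) a b).token = c.vertex := by
  cases a <;> cases b <;> rfl

theorem BiddingArena.next_inter {V Q : Type} {N : ℕ} (G : BiddingArena V Q N)
    (c : Config V Q N) (b₁ b₂ : Fin (N + 1)) (a₁ a₂ : Action V N) :
    G.concurrent.next (.inter c b₁ b₂) a₁ a₂ =
      match (match G.winner c b₁ b₂ with | .one => a₁ | .two => a₂) with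
      | .move v => .config (G.outcome c b₁ b₂ v)
      | .bid _ => .inter c b₁ b₂ := by
  cases a₁ <;> cases a₂ <;> rfl

namespace ConcurrentArena

variable {A V : Type} (G : ConcurrentArena A V)

open Classical in
/-- A player who controls the vertex `v` of a turn-based game. -/
noncomputable def owner (v : V) : Player := if G.Controls .one v then .one else .two

theorem IsTurnBased.controls_owner {G : ConcurrentArena A V} (h : G.IsTurnBased) (v : V) :
    G.Controls (G.owner v) v := by
  unfold owner
  split_ifs with hc
  · exact hc
  · obtain ⟨_ | _, hi⟩ := h v
    exacts [absurd hi hc, hi]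

/-- The bidding game of a turn-based game: the total budget is `0`, so that all biddings are ties,
and the transducer remembers the location of the token and lets the player who controls it win. -/
noncomputable def toBidding (v₀ : V) : BiddingArena V V 0 where
  edge v := {u | ∃ a ∈ G.allowed v .one, ∃ b ∈ G.allowed v .two, G.next v a b = u}
  edge_nonempty v :=
    let ⟨a, ha⟩ := G.allowed_nonempty v .one
    let ⟨b, hb⟩ := G.allowed_nonempty v .two
    ⟨_, a, ha, b, hb, rfl⟩
  transducer :=
    { init := v₀
      step := fun _ l => l.1
      label := G.owner }

variable {G} {v₀ : V}

theorem toBidding_forces_config {c : Config V V 0} {T : Set (Position V V 0)} :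
    (G.toBidding v₀).concurrent.Forces (.config c) T ↔ .inter c 0 0 ∈ T := by
  constructor
  · rintro ⟨_, ⟨b, _, rfl⟩, h⟩
    have := h (.bid 0) ⟨0, by simp, rfl⟩
    rwa [show b = 0 from Subsingleton.elim (α := Fin 1) b 0] at this
  · rintro h
    refine ⟨.bid 0, ⟨0, by simp, rfl⟩, ?_⟩
    rintro _ ⟨b, _, rfl⟩
    rw [show b = 0 from Subsingleton.elim (α := Fin 1) b 0]
    exact h

theorem toBidding_winner (v : V) : (G.toBidding v₀).winner ⟨v, 0, v⟩ 0 0 = G.owner v := by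
  simp [BiddingArena.winner, toBidding]

theorem toBidding_next_inter {v u : V} {a b : Action V 0}
    (h : (match G.owner v with | .one => a | .two => b) = .move u) :
    (G.toBidding v₀).concurrent.next (.inter ⟨v, 0, v⟩ 0 0) a b = .config ⟨u, 0, u⟩ := by
  have hw : (G.toBidding v₀).outcome ⟨v, 0, v⟩ 0 0 u = ⟨u, 0, u⟩ := by
    unfold BiddingArena.outcome
    cases (G.toBidding v₀).winner ⟨v, 0, v⟩ 0 0 <;> simp [toBidding]
  rw [BiddingArena.next_inter, toBidding_winner, h, ← hw]

theorem toBidding_mem_allowed_inter {v : V} {i : Player} {a : Action V 0} :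
    a ∈ (G.toBidding v₀).concurrent.allowed (.inter ⟨v, 0, v⟩ 0 0) i ↔
      (i = G.owner v → ∃ a₁ ∈ G.allowed v .one, ∃ b₁ ∈ G.allowed v .two,
        a = .move (G.next v a₁ b₁)) := by
  rw [← toBidding_winner (v₀ := v₀)]
  refine imp_congr_right fun _ => ⟨?_, ?_⟩
  · rintro ⟨_, ⟨a₁, ha₁, b₁, hb₁, rfl⟩, rfl⟩
    exact ⟨a₁, ha₁, b₁, hb₁, rfl⟩
  · rintro ⟨a₁, ha₁, b₁, hb₁, rfl⟩
    exact ⟨_, ⟨a₁, ha₁, b₁, hb₁, rfl⟩, rfl⟩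

theorem IsTurnBased.toBidding_playerOneWins (hG : G.IsTurnBased) (α : QualitativeObjective)
    {d : α.Data} (col : V → Fin (α.numColours d)) (v : V) :
    G.PlayerOneWins (α.winningPaths d col) v ↔ (G.toBidding v₀).concurrent.PlayerOneWins
      (α.winningPaths d fun p => col p.token) (.config ⟨v, 0, v⟩) := by
  refine playerOneWins_double α G (G.toBidding v₀).concurrent (fun v => .config ⟨v, 0, v⟩)
    col (fun p => col p.token) (fun v => rfl)
    (fun v a b => congrArg col (BiddingArena.token_next_config _ _ a b)) ?_ ?_ v
  · rintro v S ⟨a, ha, h⟩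
    rw [toBidding_forces_config]
    have hc := hG.controls_owner v
    cases ho : G.owner v with
    | one =>
      obtain ⟨b, hb⟩ := G.allowed_nonempty v .two
      refine ⟨.move (G.next v a b), toBidding_mem_allowed_inter.2 fun _ =>
        ⟨a, ha, b, hb, rfl⟩, fun b' _ => ?_⟩
      rw [toBidding_next_inter (u := G.next v a b) (by rw [ho])]
      exact ⟨_, h b hb, rfl⟩
    | two =>
      refine ⟨.bid 0, toBidding_mem_allowed_inter.2 fun h => by simp [ho] at h,
        fun b' hb' => ?_⟩
      rw [toBidding_mem_allowed_inter] at hb'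
      obtain ⟨a₁, ha₁, b₁, hb₁, rfl⟩ := hb' ho.symm
      rw [ho] at hc
      obtain ⟨u, hu⟩ := hc b₁ hb₁
      rw [toBidding_next_inter (u := G.next v a₁ b₁) (by rw [ho]),
        show G.next v a₁ b₁ = G.next v a b₁ from (hu a₁ ha₁).trans (hu a ha).symm]
      exact ⟨_, h b₁ hb₁, rfl⟩
  · intro v T h
    rw [toBidding_forces_config] at h
    obtain ⟨x, hx, h⟩ := h
    rw [toBidding_mem_allowed_inter] at hx
    have hc := hG.controls_owner v
    cases ho : G.owner v with
    | one =>
      obtain ⟨a, ha, b, hb, rfl⟩ := hx ho.symm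
      rw [ho] at hc
      refine ⟨{G.next v a b}, ⟨a, ha, fun b' hb' => ?_⟩, ?_⟩
      · obtain ⟨u, hu⟩ := hc a ha
        exact (hu b' hb').trans (hu b hb).symm
      · rw [Set.image_singleton, Set.singleton_subset_iff]
        have := h (.bid 0) (toBidding_mem_allowed_inter.2 fun h => by simp [ho] at h)
        rwa [toBidding_next_inter (u := G.next v a b) (by rw [ho])] at this
    | two =>
      obtain ⟨a, ha⟩ := G.allowed_nonempty v .one
      refine ⟨{u | ∃ b ∈ G.allowed v .two, u = G.next v a b},
        ⟨a, ha, fun b hb => ⟨b, hb, rfl⟩⟩, ?_⟩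
      rintro _ ⟨_, ⟨b, hb, rfl⟩, rfl⟩
      have := h (.move (G.next v a b)) (toBidding_mem_allowed_inter.2 fun _ =>
        ⟨a, ha, b, hb, rfl⟩)
      rwa [toBidding_next_inter (u := G.next v a b) (by rw [ho])] at this

end ConcurrentArena

/-- The bidding game that corresponds to an instance of `TB-WIN`. -/
noncomputable def TBInstance.toBid {α : QualitativeObjective} (I : TBInstance α) :
    BidInstance α where
  numVertices := I.numVertices
  numStates := I.numVertices
  totalBudget := 0
  arena := I.arena.toBidding I.start
  data := I.data
  colour := I.colour
  start := ⟨I.start, 0, I.start⟩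

theorem TBInstance.toBid_unawareOfTies {α : QualitativeObjective} (I : TBInstance α) :
    I.toBid.arena.UnawareOfTies := fun _ _ _ _ => rfl

theorem TBInstance.toBid_yes {α : QualitativeObjective} (I : TBInstance α) :
    (tbWin α).Yes I ↔ (bidWin α).Yes I.toBid :=
  I.turnBased.toBidding_playerOneWins α I.colour I.start

/-! ### Programs that read and write tables -/

theorem table_eq_flatMap {X : Type} {n : ℕ} {f : Fin n → List X} {g : ℕ → List X}
    (h : ∀ i : Fin n, f i = g i) : table f = (List.range n).flatMap g := by
  rw [table, List.flatMap_def]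
  congr 1
  apply List.ext_getElem <;> simp [h]

theorem table_getD {n L : ℕ} {f : Fin n → List ℕ} (hf : ∀ i, (f i).length = L) (i : Fin n) {j : ℕ}
    (hj : j < L) (R : List ℕ) : (table f ++ R).getD (i * L + j) 0 = (f i).getD j 0 := by
  induction n with
  | zero => exact i.elim0
  | succ n ih =>
    have h0 : table f ++ R = f 0 ++ (table (fun i => f i.succ) ++ R) := by
      simp [table, List.ofFn_succ]
    rw [h0]
    cases i using Fin.cases with
    | zero => rw [List.getD_append _ _ _ _ (by simp [hf, hj])]; simp
    | succ i =>
      rw [List.getD_append_right _ _ _ _ (by rw [hf, Fin.val_succ]; nlinarith), hf,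
        show (i.succ : ℕ) * L + j - L = i * L + j by
          rw [Fin.val_succ, Nat.add_mul, one_mul]; omega]
      exact ih (fun i => hf i.succ) i

theorem table_getD' {n L : ℕ} {f : Fin n → List ℕ} (hf : ∀ i, (f i).length = L) (i : Fin n) {j : ℕ}
    (hj : j < L) : (table f).getD (i * L + j) 0 = (f i).getD j 0 := by
  simpa using table_getD hf i hj []

/-- Reading an entry of a table that starts at the index `k` of a list. -/
theorem getD_table_of_eq {A P R : List ℕ} {n L k : ℕ} {f : Fin n → List ℕ}
    (hA : A = P ++ (table f ++ R)) (hP : P.length = k) (hf : ∀ i, (f i).length = L) (i : Fin n)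
    {j : ℕ} (hj : j < L) : A.getD (k + (i * L + j)) 0 = (f i).getD j 0 := by
  rw [hA, List.getD_append_right _ _ _ _ (by omega), hP, Nat.add_sub_cancel_left,
    table_getD hf i hj]

theorem flatMap_range_getD (A : List ℕ) (k : ℕ) :
    ((List.range (A.length - k)).flatMap fun i => [A.getD (k + i) 0]) = A.drop k := by
  rw [← List.map_eq_flatMap]
  apply List.ext_getElem
  · simp
  · intro i h1 h2
    simp only [List.length_drop] at h2
    simp only [List.getElem_map, List.getElem_range, List.getElem_drop]
    exact List.getD_eq_getElem _ _ (by omega)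

namespace Expr

instance : Add Expr := ⟨add⟩
instance : Mul Expr := ⟨mul⟩
instance : Sub Expr := ⟨sub⟩
instance (n : ℕ) : OfNat Expr n := ⟨const n⟩

/-- `a` if `e < f`, and `b` otherwise. -/
def ifLt (e f a b : Expr) : Expr := ifPos (f - e) a b

/-- `a` if `e = f`, and `b` otherwise. -/
def ifEq (e f a b : Expr) : Expr := ifLt e f b (ifLt f e b a)

section

variable (A : List ℕ) (ρ : ℕ → ℕ) (e f a b : Expr)

@[simp] theorem eval_ofNat (n : ℕ) : eval A (ofNat(n) : Expr) ρ = OfNat.ofNat n := rfl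
@[simp] theorem eval_var (x : ℕ) : eval A (var x) ρ = ρ x := rfl
@[simp] theorem eval_input : eval A (input e) ρ = A.getD (e.eval A ρ) 0 := rfl
@[simp] theorem eval_len : eval A len ρ = A.length := rfl
@[simp] theorem eval_add : eval A (e + f) ρ = e.eval A ρ + f.eval A ρ := rfl
@[simp] theorem eval_mul : eval A (e * f) ρ = e.eval A ρ * f.eval A ρ := rfl
@[simp] theorem eval_sub : eval A (e - f) ρ = e.eval A ρ - f.eval A ρ := rfl
@[simp] theorem eval_ifPos : eval A (ifPos e a b) ρ =
    if 0 < e.eval A ρ then a.eval A ρ else b.eval A ρ := rfl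
@[simp] theorem eval_sum (x : ℕ) : eval A (sum x e f) ρ =
    ∑ i ∈ Finset.range (e.eval A ρ), f.eval A (Function.update ρ x i) := rfl

@[simp] theorem eval_ifLt : eval A (ifLt e f a b) ρ =
    if e.eval A ρ < f.eval A ρ then a.eval A ρ else b.eval A ρ := by
  simp [ifLt]

@[simp] theorem eval_ifEq : eval A (ifEq e f a b) ρ =
    if e.eval A ρ = f.eval A ρ then a.eval A ρ else b.eval A ρ := by
  simp only [ifEq, eval_ifLt]
  split_ifs <;> omega

end

end Expr

theorem bit_eq_ite (p : Prop) [Decidable p] : bit p = if p then 1 else 0 := by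
  unfold bit
  congr

@[simp] theorem bit_pos (p : Prop) : 0 < bit p ↔ p := by
  classical
  rw [bit_eq_ite]
  split_ifs with h <;> simp [h]

theorem sum_range_pos {n : ℕ} {f : ℕ → ℕ} :
    0 < ∑ i ∈ Finset.range n, f i ↔ ∃ i : Fin n, 0 < f i := by
  simp [Finset.sum_pos_iff, Fin.exists_iff]

theorem one_zero_pos (p : Prop) [Decidable p] : 0 < (if p then 1 else 0 : ℕ) ↔ p := by
  split_ifs with h <;> simp [h]

namespace Emit

instance : Append Emit := ⟨seq⟩

section

variable (A : List ℕ) (ρ : ℕ → ℕ)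

theorem eval_append (P Q : Emit) : eval A (P ++ Q) ρ = P.eval A ρ ++ Q.eval A ρ := rfl

theorem eval_emit (e : Expr) : eval A (emit e) ρ = [e.eval A ρ] := rfl

theorem eval_loop (x : ℕ) (e : Expr) (P : Emit) : eval A (loop x e P) ρ =
    (List.range (e.eval A ρ)).flatMap fun i => P.eval A (Function.update ρ x i) := rfl

end

/-- Write the entries of the input from index `e` on. -/
def rest (e : Expr) : Emit := loop 0 (.len - e) (emit (.input (e + .var 0)))

theorem eval_rest {A : List ℕ} {e : Expr} {k : ℕ} (h : ∀ ρ, e.eval A ρ = k) (ρ : ℕ → ℕ) :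
    (rest e).eval A ρ = A.drop k := by
  rw [← flatMap_range_getD]
  simp only [rest, eval_loop, eval_emit, Expr.eval_sub, Expr.eval_len, Expr.eval_input,
    Expr.eval_add, Expr.eval_var, h, Function.update_self]

end Emit

/-! ### The reduction of `TB-WIN` to `BID-WIN` is computable in polynomial time -/

namespace TBInstance

open BiddingGames.Expr Emit

/-- The number of actions, read from the code of a turn-based game. -/
def actionsExpr : Expr := .input 0

/-- The number of vertices. -/
def verticesExpr : Expr := .input 1

/-- The initial vertex. -/
def startExpr : Expr := .input 2

/-- Whether the action `a` is allowed in `v` for Player 1 (`i = 0`) or Player 2 (`i = 1`). -/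
def allowedExpr (v a i : Expr) : Expr := .input (3 + (v * (actionsExpr * 2) + (a * 2 + i)))

/-- The index of the transition table in the code. -/
def nextOffset : Expr := 3 + verticesExpr * (actionsExpr * 2)

/-- The successor of `v` for the actions `a` and `b`. -/
def nextExpr (v a b : Expr) : Expr :=
  .input (nextOffset + (v * (actionsExpr * actionsExpr) + (a * actionsExpr + b)))

/-- The index of the colours in the code. -/
def colourOffset : Expr := nextOffset + verticesExpr * (actionsExpr * actionsExpr)

/-- The colour of `v`. -/
def colourExpr (v : Expr) : Expr := .input (colourOffset + v)

/-- The code of the datum of the objective. -/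
def dataEmit : Emit := rest (colourOffset + verticesExpr)

section

variable {α : QualitativeObjective} (I : TBInstance α) {ρ : ℕ → ℕ}

theorem eval_actionsExpr : actionsExpr.eval I.code ρ = I.numActions := rfl

theorem eval_verticesExpr : verticesExpr.eval I.code ρ = I.numVertices := rfl

theorem eval_startExpr : startExpr.eval I.code ρ = I.start := rfl

theorem length_allowedTable (v : Fin I.numVertices) : (table fun a =>
    [bit (a ∈ I.arena.allowed v .one), bit (a ∈ I.arena.allowed v .two)]).length =
      I.numActions * 2 :=
  table_length fun _ => rfl

theorem length_nextTable (v : Fin I.numVertices) : (table fun a => table fun b =>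
    [(I.arena.next v a b : ℕ)]).length = I.numActions * I.numActions :=
  table_length fun _ => by rw [table_length (L := 1) fun _ => rfl, mul_one]

theorem eval_allowedExpr {e f : Expr} {v : Fin I.numVertices} {a : Fin I.numActions}
    (he : e.eval I.code ρ = v) (hf : f.eval I.code ρ = a) :
    (allowedExpr e f 0).eval I.code ρ = bit (a ∈ I.arena.allowed v .one) ∧
      (allowedExpr e f 1).eval I.code ρ = bit (a ∈ I.arena.allowed v .two) := by
  have key : ∀ i < 2, I.code.getD (3 + ((v : ℕ) * (I.numActions * 2) + ((a : ℕ) * 2 + i))) 0 =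
      [bit (a ∈ I.arena.allowed v .one), bit (a ∈ I.arena.allowed v .two)].getD i 0 := by
    intro i hi
    have ha := a.2
    refine (getD_table_of_eq (P := [I.numActions, I.numVertices, (I.start : ℕ)])
      (by simp only [code, List.append_assoc]; rfl) rfl I.length_allowedTable v
      (by nlinarith)).trans ?_
    exact table_getD' (f := fun a => [bit (a ∈ I.arena.allowed v .one),
      bit (a ∈ I.arena.allowed v .two)]) (fun _ => rfl) a hi
  simp only [allowedExpr, eval_input, eval_add, eval_mul, he, hf, eval_actionsExpr]
  exact ⟨key 0 (by omega), key 1 (by omega)⟩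

theorem eval_nextOffset :
    nextOffset.eval I.code ρ = 3 + I.numVertices * (I.numActions * 2) := rfl

theorem eval_colourOffset : colourOffset.eval I.code ρ = 3 + I.numVertices * (I.numActions * 2) +
    I.numVertices * (I.numActions * I.numActions) := rfl

theorem eval_nextExpr {e f g : Expr} {v : Fin I.numVertices} {a b : Fin I.numActions}
    (he : e.eval I.code ρ = v) (hf : f.eval I.code ρ = a) (hg : g.eval I.code ρ = b) :
    (nextExpr e f g).eval I.code ρ = I.arena.next v a b := by
  have hb := b.2
  have ha := a.2
  simp only [nextExpr, eval_input, eval_add, eval_mul, he, hf, hg, eval_actionsExpr,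
    eval_nextOffset]
  refine (getD_table_of_eq (P := [I.numActions, I.numVertices, (I.start : ℕ)] ++ _)
    (by simp only [code, List.append_assoc]; rfl)
    (by rw [List.length_append, table_length I.length_allowedTable]; rfl) I.length_nextTable v
    (by nlinarith)).trans ?_
  refine (table_getD' (f := fun a => table fun b => [(I.arena.next v a b : ℕ)])
    (fun _ => by rw [table_length (L := 1) fun _ => rfl, mul_one]) a hb).trans ?_
  simpa using table_getD' (f := fun b => [(I.arena.next v a b : ℕ)]) (L := 1) (fun _ => rfl) b
    one_pos

theorem eval_colourExpr {e : Expr} {v : Fin I.numVertices} (he : e.eval I.code ρ = v) :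
    (colourExpr e).eval I.code ρ = I.colour v := by
  simp only [colourExpr, eval_input, eval_add, he, eval_colourOffset]
  have := getD_table_of_eq (A := I.code) (f := fun v => [(I.colour v : ℕ)])
    (P := [I.numActions, I.numVertices, (I.start : ℕ)] ++ _ ++ _)
    (by simp only [code, List.append_assoc]; rfl)
    (by rw [List.length_append, List.length_append, table_length I.length_allowedTable,
      table_length I.length_nextTable]) (fun _ => rfl) v one_pos
  rw [Nat.mul_one, Nat.add_zero] at this
  exact this

theorem eval_dataEmit : dataEmit.eval I.code ρ = α.code I.data := by
  rw [dataEmit, eval_rest (k := 3 + I.numVertices * (I.numActions * 2) +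
    I.numVertices * (I.numActions * I.numActions) + I.numVertices) (fun ρ => rfl)]
  refine List.drop_left' ?_
  simp only [List.length_append]
  rw [table_length I.length_allowedTable, table_length I.length_nextTable,
    table_length (L := 1) fun _ => rfl]
  simp

end

/-- The entry of the edge relation of the bidding game. -/
def edgeExpr (v u : Expr) : Expr :=
  ifPos (sum 2 actionsExpr <| sum 3 actionsExpr <|
    allowedExpr v (.var 2) 0 * allowedExpr v (.var 3) 1 *
      ifEq (nextExpr v (.var 2) (.var 3)) u 1 0) 1 0

/-- The code of the owner of `v`: it is Player 2 iff there are an action of Player 1 and two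
actions of Player 2 that lead to different vertices. -/
def ownerExpr (v : Expr) : Expr :=
  ifPos (sum 2 actionsExpr <| sum 3 actionsExpr <| sum 4 actionsExpr <|
    allowedExpr v (.var 2) 0 * allowedExpr v (.var 3) 1 * allowedExpr v (.var 4) 1 *
      ifEq (nextExpr v (.var 2) (.var 3)) (nextExpr v (.var 2) (.var 4)) 0 1) 1 0

/-- The program that computes the code of the bidding game of a turn-based game. -/
def toBidEmit : Emit :=
  emit verticesExpr ++ emit verticesExpr ++ emit 0 ++ emit startExpr ++ emit 0 ++ emit startExpr ++
    emit startExpr ++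
  loop 0 verticesExpr (loop 1 verticesExpr (emit (edgeExpr (.var 0) (.var 1)))) ++
  loop 0 verticesExpr (emit (ownerExpr (.var 0))) ++
  loop 0 verticesExpr (loop 1 verticesExpr (loop 2 1
    (emit (.var 1) ++ emit (.var 1) ++ emit (.var 1) ++ emit (.var 1)))) ++
  loop 0 verticesExpr (emit (colourExpr (.var 0))) ++
  dataEmit

variable {α : QualitativeObjective} (I : TBInstance α) {ρ : ℕ → ℕ}

theorem eval_edgeExpr {v u : Fin I.numVertices} (hv : ρ 0 = v) (hu : ρ 1 = u) :
    (edgeExpr (.var 0) (.var 1)).eval I.code ρ = bit (u ∈ I.toBid.arena.edge v) := by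
  classical
  rw [bit_eq_ite, edgeExpr, eval_ifPos]
  refine if_congr ?_ rfl rfl
  have : u ∈ I.toBid.arena.edge v ↔ ∃ a b, a ∈ I.arena.allowed v .one ∧
      b ∈ I.arena.allowed v .two ∧ I.arena.next v a b = u := by
    constructor
    · rintro ⟨a, ha, b, hb, h⟩
      exact ⟨a, b, ha, hb, h⟩
    · rintro ⟨a, b, ha, hb, h⟩
      exact ⟨a, ha, b, hb, h⟩
  rw [this, eval_sum, eval_actionsExpr, sum_range_pos]
  refine exists_congr fun a => ?_
  rw [eval_sum, eval_actionsExpr, sum_range_pos]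
  refine exists_congr fun b => ?_
  rw [eval_mul, eval_mul, eval_ifEq,
    (I.eval_allowedExpr (v := v) (a := a) (by simp [hv]) (by simp)).1,
    (I.eval_allowedExpr (v := v) (a := b) (by simp [hv]) (by simp)).2,
    I.eval_nextExpr (v := v) (a := a) (b := b) (by simp [hv]) (by simp) (by simp)]
  simp only [eval_ofNat, eval_var, CanonicallyOrderedAdd.mul_pos, bit_pos]
  simp [hu, and_assoc, Fin.ext_iff]
  exact fun _ _ => one_zero_pos _

theorem eval_ownerExpr {v : Fin I.numVertices} (hv : ρ 0 = v) :
    (ownerExpr (.var 0)).eval I.code ρ = (I.arena.owner v).code := by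
  classical
  have : (I.arena.owner v).code = if ∃ a b b', a ∈ I.arena.allowed v .one ∧
      b ∈ I.arena.allowed v .two ∧ b' ∈ I.arena.allowed v .two ∧
        I.arena.next v a b ≠ I.arena.next v a b' then 1 else 0 := by
    unfold ConcurrentArena.owner
    split_ifs with h1 h2 h2
    · obtain ⟨a, b, b', ha, hb, hb', h⟩ := h2
      obtain ⟨u, hu⟩ := h1 a ha
      exact absurd ((hu b hb).trans (hu b' hb').symm) h
    · rfl
    · rfl
    · refine absurd (fun a ha => ?_) h1
      obtain ⟨b, hb⟩ := I.arena.allowed_nonempty v .two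
      refine ⟨I.arena.next v a b, fun b' hb' => ?_⟩
      by_contra h
      exact h2 ⟨a, b', b, ha, hb', hb, h⟩
  rw [this, ownerExpr, eval_ifPos]
  refine if_congr ?_ rfl rfl
  rw [eval_sum, eval_actionsExpr, sum_range_pos]
  refine exists_congr fun a => ?_
  rw [eval_sum, eval_actionsExpr, sum_range_pos]
  refine exists_congr fun b => ?_
  rw [eval_sum, eval_actionsExpr, sum_range_pos]
  refine exists_congr fun b' => ?_
  rw [eval_mul, eval_mul, eval_mul, eval_ifEq,
    (I.eval_allowedExpr (v := v) (a := a) (by simp [hv]) (by simp)).1,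
    (I.eval_allowedExpr (v := v) (a := b) (by simp [hv]) (by simp)).2,
    (I.eval_allowedExpr (v := v) (a := b') (by simp [hv]) (by simp)).2,
    I.eval_nextExpr (v := v) (a := a) (b := b) (by simp [hv]) (by simp) (by simp),
    I.eval_nextExpr (v := v) (a := a) (b := b') (by simp [hv]) (by simp) (by simp)]
  rw [← ite_not]
  simp only [eval_ofNat, CanonicallyOrderedAdd.mul_pos, bit_pos, one_zero_pos]
  simp [and_assoc, Fin.ext_iff]

theorem eval_toBidEmit : toBidEmit.eval I.code 0 = I.toBid.code := by
  simp only [toBidEmit, eval_append, eval_emit, eval_loop, eval_verticesExpr, eval_startExpr,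
    eval_dataEmit, BidInstance.code]
  congr 1
  congr 1
  · congr 1
    · congr 1
      · congr 1
        exact (table_eq_flatMap fun v => table_eq_flatMap fun u => by
          rw [I.eval_edgeExpr (v := v) (u := u) (by simp) (by simp)]; rfl).symm
      · exact (table_eq_flatMap fun v => by rw [I.eval_ownerExpr (v := v) (by simp)]; rfl).symm
    · exact (table_eq_flatMap fun v => table_eq_flatMap fun u => table_eq_flatMap fun b => by
        simp only [eval_var]; rfl).symm
  · exact (table_eq_flatMap fun v => by rw [I.eval_colourExpr (v := v) (by simp)]; rfl).symm

end TBInstance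

theorem tbWin_reducible_bidWin (α : QualitativeObjective) :
    PolyTimeReducible (tbWin α) (bidWin α) :=
  ⟨TBInstance.toBid, TBInstance.toBidEmit.computableInPolyTime _ _ _ fun I => I.eval_toBidEmit,
    fun I => I.toBid_yes⟩

theorem tbWin_reducible_bidWinUnaware (α : QualitativeObjective) :
    PolyTimeReducible (tbWin α) (bidWinUnaware α) :=
  ⟨fun I => ⟨I.toBid, I.toBid_unawareOfTies⟩,
    TBInstance.toBidEmit.computableInPolyTime _
      (fun I : {I : BidInstance α // I.arena.UnawareOfTies} => I.1.code) _
      fun I => I.eval_toBidEmit,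
    fun I => I.toBid_yes⟩

end BiddingGames

/-! ### From bidding games to turn-based games -/

namespace BiddingGames

namespace ConcurrentArena

variable {A V A' W : Type} (G : ConcurrentArena A V) {decA : A' → A} (hA : decA.Surjective)
  (dec : W → V × Option A) (enc : V × Option A → W)

/-- The turn-based game in which Player 1 announces his action before Player 2 acts. The vertices
`(v, none)` are those of `G`, and in the vertices `(v, some a)` Player 1 has announced `a` in `v`.
The actions and vertices are given by codes; the action of the player who does not move is
irrelevant. -/
def sequential : ConcurrentArena A' W where
  allowed w i := {x | decA x ∈ G.allowed (dec w).1 i}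
  allowed_nonempty w i :=
    let ⟨a, ha⟩ := G.allowed_nonempty (dec w).1 i
    let ⟨x, hx⟩ := hA a
    ⟨x, by rwa [Set.mem_ofPred_eq, hx]⟩
  next w x y := match dec w with
    | (v, none) => enc (v, some (decA x))
    | (v, some a) => enc (G.next v a (decA y), none)

theorem sequential_isTurnBased : (G.sequential hA dec enc).IsTurnBased := by
  intro w
  rcases hw : dec w with ⟨v, _ | a⟩
  · exact ⟨.one, fun x _ => ⟨enc (v, some (decA x)), fun y _ => by
      simp [nextFor, sequential, hw]⟩⟩
  · exact ⟨.two, fun x _ => ⟨enc (G.next v a (decA x), none), fun y _ => by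
      simp [nextFor, sequential, hw]⟩⟩

variable {dec enc}

theorem sequential_forces_none (h : ∀ p, dec (enc p) = p) (v : V) (T : Set W) :
    (G.sequential hA dec enc).Forces (enc (v, none)) T ↔
      ∃ a ∈ G.allowed v .one, enc (v, some a) ∈ T := by
  obtain ⟨b, hb⟩ := (G.sequential hA dec enc).allowed_nonempty (enc (v, none)) .two
  simp only [sequential, h, Set.mem_ofPred_eq] at hb
  simp only [Forces, sequential, h, Set.mem_ofPred_eq]
  constructor
  · rintro ⟨x, hx, hT⟩
    exact ⟨decA x, hx, hT b hb⟩
  · rintro ⟨a, ha, hT⟩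
    obtain ⟨x, rfl⟩ := hA a
    exact ⟨x, ha, fun _ _ => hT⟩

theorem sequential_forces_some (h : ∀ p, dec (enc p) = p) (v : V) (a : A) (T : Set W) :
    (G.sequential hA dec enc).Forces (enc (v, some a)) T ↔
      ∀ b ∈ G.allowed v .two, enc (G.next v a b, none) ∈ T := by
  obtain ⟨x, hx⟩ := (G.sequential hA dec enc).allowed_nonempty (enc (v, some a)) .one
  simp only [sequential, h, Set.mem_ofPred_eq] at hx
  simp only [Forces, sequential, h, Set.mem_ofPred_eq]
  constructor
  · rintro ⟨_, -, hT⟩ b hb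
    obtain ⟨y, rfl⟩ := hA b
    exact hT y hb
  · intro hT
    exact ⟨x, hx, fun y hy => hT _ hy⟩

/-- Announcing the actions of Player 1 does not change whether he wins, since a winning strategy has
to win even against those strategies of Player 2 that anticipate his actions. -/
theorem sequential_playerOneWins (h : ∀ p, dec (enc p) = p) (α : QualitativeObjective) {d : α.Data}
    (col : V → Fin (α.numColours d)) (v : V) :
    G.PlayerOneWins (α.winningPaths d col) v ↔ (G.sequential hA dec enc).PlayerOneWins
      (α.winningPaths d fun w => col (dec w).1) (enc (v, none)) := by
  refine playerOneWins_double α G _ (fun v => enc (v, none)) col _ (fun v => by rw [h])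
    (fun v x y => by simp [sequential, h]) ?_ ?_ v
  · rintro v S ⟨a, ha, hS⟩
    rw [G.sequential_forces_none hA h]
    refine ⟨a, ha, ?_⟩
    rw [Set.mem_ofPred_eq, G.sequential_forces_some hA h]
    exact fun b hb => ⟨_, hS b hb, rfl⟩
  · intro v T hT
    rw [G.sequential_forces_none hA h] at hT
    obtain ⟨a, ha, hT⟩ := hT
    rw [Set.mem_ofPred_eq, G.sequential_forces_some hA h] at hT
    refine ⟨{u | ∃ b ∈ G.allowed v .two, u = G.next v a b}, ⟨a, ha, fun b hb => ⟨b, hb, rfl⟩⟩, ?_⟩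
    rintro _ ⟨_, ⟨b, hb, rfl⟩, rfl⟩
    exact hT b hb

end ConcurrentArena

section coding

variable {n q N : ℕ}

/-- The numbering of the actions of a bidding game: first the bids, then the moves. -/
def decodeAction (x : Fin (N + 1 + n)) : Action (Fin n) N :=
  if h : (x : ℕ) < N + 1 then .bid ⟨x, h⟩ else .move ⟨x - (N + 1), by omega⟩

/-- The number of an action, inverse to `decodeAction`. -/
def encodeAction : Action (Fin n) N → Fin (N + 1 + n)
  | .bid b => ⟨b, by omega⟩
  | .move v => ⟨N + 1 + v, by omega⟩

theorem decodeAction_encodeAction (a : Action (Fin n) N) : decodeAction (encodeAction a) = a := by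
  cases a <;> simp [decodeAction, encodeAction] <;> omega

theorem decodeAction_surjective : (decodeAction (n := n) (N := N)).Surjective :=
  fun a => ⟨_, decodeAction_encodeAction a⟩

/-- Optional actions are coded by actions and one additional number. -/
def decodeOption (w : Fin (N + 1 + n + 1)) : Option (Action (Fin n) N) :=
  if h : (w : ℕ) < N + 1 + n then some (decodeAction ⟨w, h⟩) else none

/-- The number of an optional action: the largest number stands for `none`. -/
def encodeOption : Option (Action (Fin n) N) → Fin (N + 1 + n + 1)
  | none => Fin.last _
  | some a => (encodeAction a).castSucc

theorem decodeOption_encodeOption (o : Option (Action (Fin n) N)) :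
    decodeOption (encodeOption o) = o := by
  cases o with
  | none => simp [decodeOption, encodeOption]
  | some a =>
    rw [decodeOption, dif_pos (by exact (encodeAction a).2)]
    exact congrArg some (decodeAction_encodeAction a)

/-- Positions are coded by a configuration and two numbers: bids, or at least one number larger than
all bids if there are no bids yet. -/
def decodePosition (c : Config (Fin n) (Fin q) N) (x y : Fin (N + 1 + 1)) :
    Position (Fin n) (Fin q) N :=
  if h : (x : ℕ) < N + 1 ∧ (y : ℕ) < N + 1 then .inter c ⟨x, h.1⟩ ⟨y, h.2⟩ else .config c

/-- The number of vertices of the turn-based game of a bidding game. -/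
abbrev sequentialSize (n q N : ℕ) : ℕ :=
  n * ((N + 1) * (q * ((N + 1 + 1) * ((N + 1 + 1) * (N + 1 + n + 1)))))

/-- The numbering of the tuples that code a position and an optional action. -/
def packVertex (v : Fin n) (B : Fin (N + 1)) (s : Fin q) (x y : Fin (N + 1 + 1))
    (w : Fin (N + 1 + n + 1)) : Fin (sequentialSize n q N) :=
  finProdFinEquiv (v, finProdFinEquiv (B, finProdFinEquiv (s, finProdFinEquiv (x,
    finProdFinEquiv (y, w)))))

/-- The position, and the announced action if there is one, that a vertex of the turn-based game
stands for. This is not injective, as a position without bids has several codes. -/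
def decodeVertex (k : Fin (sequentialSize n q N)) :
    Position (Fin n) (Fin q) N × Option (Action (Fin n) N) :=
  let k₁ := finProdFinEquiv.symm k
  let k₂ := finProdFinEquiv.symm k₁.2
  let k₃ := finProdFinEquiv.symm k₂.2
  let k₄ := finProdFinEquiv.symm k₃.2
  let k₅ := finProdFinEquiv.symm k₄.2
  (decodePosition ⟨k₁.1, k₂.1, k₃.1⟩ k₄.1 k₅.1, decodeOption k₅.2)

/-- The canonical code of a position and an optional action. -/
def encodeVertex :
    Position (Fin n) (Fin q) N × Option (Action (Fin n) N) → Fin (sequentialSize n q N)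
  | (.config c, o) =>
    packVertex c.vertex c.budgetOne c.state (Fin.last _) (Fin.last _) (encodeOption o)
  | (.inter c b₁ b₂, o) =>
    packVertex c.vertex c.budgetOne c.state b₁.castSucc b₂.castSucc (encodeOption o)

theorem decodeVertex_packVertex (v : Fin n) (B : Fin (N + 1)) (s : Fin q) (x y : Fin (N + 1 + 1))
    (w : Fin (N + 1 + n + 1)) : decodeVertex (packVertex v B s x y w) =
      (decodePosition ⟨v, B, s⟩ x y, decodeOption w) := by
  simp only [decodeVertex, packVertex, Equiv.symm_apply_apply]

theorem decodeVertex_encodeVertex (p : Position (Fin n) (Fin q) N × Option (Action (Fin n) N)) :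
    decodeVertex (encodeVertex p) = p := by
  rcases p with ⟨c | ⟨c, b₁, b₂⟩, o⟩
  · simp [encodeVertex, decodeVertex_packVertex, decodeOption_encodeOption, decodePosition]
  · simp [encodeVertex, decodeVertex_packVertex, decodeOption_encodeOption, decodePosition]
    omega

theorem token_decodePosition (c : Config (Fin n) (Fin q) N) (x y : Fin (N + 1 + 1)) :
    (decodePosition c x y).token = c.vertex := by
  unfold decodePosition
  split_ifs <;> rfl

theorem table_mul {X : Type} {m n : ℕ} (f : Fin (m * n) → List X) :
    table f = table fun i => table fun j => f (finProdFinEquiv (i, j)) := by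
  unfold table
  rw [List.ofFn_mul, List.flatten_flatten, List.map_ofFn]
  have : ∀ i j, finProdFinEquiv (i, j) = (⟨i * n + j, by
      have := i.2; have := j.2; nlinarith⟩ : Fin (m * n)) := fun i j => by
    ext; simp [add_comm, mul_comm]
  simp only [this]
  rfl

/-- The table of a function on the vertices of the turn-based game is obtained by nested loops. -/
theorem table_sequential {X : Type} (f : Fin (sequentialSize n q N) → List X) :
    table f = table fun v => table fun B => table fun s => table fun x => table fun y =>
      table fun w => f (packVertex v B s x y w) := by
  simp only [table_mul]
  rfl

end coding

/-- The turn-based game that corresponds to an instance of `BID-WIN`. -/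
def BidInstance.toTB {α : QualitativeObjective} (I : BidInstance α) : TBInstance α where
  numActions := I.totalBudget + 1 + I.numVertices
  numVertices := sequentialSize I.numVertices I.numStates I.totalBudget
  arena := I.arena.concurrent.sequential decodeAction_surjective decodeVertex encodeVertex
  turnBased := ConcurrentArena.sequential_isTurnBased _ decodeAction_surjective _ _
  data := I.data
  colour k := I.colour (decodeVertex k).1.token
  start := encodeVertex (.config I.start, none)

theorem BidInstance.toTB_yes {α : QualitativeObjective} (I : BidInstance α) :
    (bidWin α).Yes I ↔ (tbWin α).Yes I.toTB :=
  ConcurrentArena.sequential_playerOneWins _ decodeAction_surjective decodeVertex_encodeVertex α _ _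

end BiddingGames

/-! ### The reduction of `BID-WIN` to `TB-WIN` is computable in polynomial time -/

namespace BiddingGames

theorem encodeAction_decodeAction {n N : ℕ} (x : Fin (N + 1 + n)) :
    encodeAction (decodeAction x) = x := by
  unfold decodeAction
  split_ifs with h
  · rfl
  · ext
    simp only [encodeAction]
    omega

namespace BidInstance

open BiddingGames.Expr Emit

/-- The number of vertices, read from the code of a bidding game. -/
def verticesExpr : Expr := .input 0

/-- The number of states of the transducer. -/
def statesExpr : Expr := .input 1

/-- The total budget. -/
def budgetExpr : Expr := .input 2

/-- The number of actions of the turn-based game. -/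
def actionsExpr : Expr := budgetExpr + 1 + verticesExpr

/-- Whether `(v, u)` is an edge. -/
def edgeExpr (v u : Expr) : Expr := .input (7 + (v * verticesExpr + u))

/-- The index of the labels of the transducer in the code. -/
def labelOffset : Expr := 7 + verticesExpr * verticesExpr

/-- The label of the state `s`. -/
def labelExpr (s : Expr) : Expr := .input (labelOffset + s)

/-- The index of the transition table of the transducer in the code. -/
def stepOffset : Expr := labelOffset + statesExpr

/-- The successor of the state `s` if Player `i` wins the bidding with the bid `b` and moves to `v`,
where `t` tells whether there was a tie. -/
def stepExpr (s v i t b : Expr) : Expr :=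
  .input (stepOffset + (s * (verticesExpr * ((budgetExpr + 1) * 4)) +
    (v * ((budgetExpr + 1) * 4) + (b * 4 + (2 * i + t)))))

/-- The index of the colours in the code. -/
def colourOffset : Expr :=
  stepOffset + statesExpr * (verticesExpr * ((budgetExpr + 1) * 4))

/-- The colour of `v`. -/
def colourExpr (v : Expr) : Expr := .input (colourOffset + v)

/-- The code of the datum of the objective. -/
def dataEmit : Emit := rest (colourOffset + verticesExpr)

section

variable {α : QualitativeObjective} (I : BidInstance α) {ρ : ℕ → ℕ}

theorem eval_verticesExpr : verticesExpr.eval I.code ρ = I.numVertices := rfl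

theorem eval_budgetExpr : budgetExpr.eval I.code ρ = I.totalBudget := rfl

theorem eval_actionsExpr :
    actionsExpr.eval I.code ρ = I.totalBudget + 1 + I.numVertices := rfl

theorem eval_labelOffset :
    labelOffset.eval I.code ρ = 7 + I.numVertices * I.numVertices := rfl

theorem eval_stepOffset :
    stepOffset.eval I.code ρ = 7 + I.numVertices * I.numVertices + I.numStates := rfl

theorem eval_colourOffset : colourOffset.eval I.code ρ = 7 + I.numVertices * I.numVertices +
    I.numStates + I.numStates * (I.numVertices * ((I.totalBudget + 1) * 4)) := rfl

/-- The numbers at the beginning of the code. -/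
def header : List ℕ :=
  [I.numVertices, I.numStates, I.totalBudget, I.start.vertex, I.start.budgetOne, I.start.state,
    I.arena.transducer.init]

theorem length_edgeTable (v : Fin I.numVertices) :
    (table fun u => [bit (u ∈ I.arena.edge v)]).length = I.numVertices := by
  rw [table_length (L := 1) fun _ => rfl, mul_one]

theorem length_stepTable (s : Fin I.numStates) : (table fun v => table fun b =>
    [(I.arena.transducer.step s (v, .one, false, b) : ℕ),
      (I.arena.transducer.step s (v, .one, true, b) : ℕ),
      (I.arena.transducer.step s (v, .two, false, b) : ℕ),
      (I.arena.transducer.step s (v, .two, true, b) : ℕ)]).length =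
      I.numVertices * ((I.totalBudget + 1) * 4) :=
  table_length fun _ => table_length fun _ => rfl

theorem eval_edgeExpr {e f : Expr} {v u : Fin I.numVertices}
    (he : e.eval I.code ρ = v) (hf : f.eval I.code ρ = u) :
    (edgeExpr e f).eval I.code ρ = bit (u ∈ I.arena.edge v) := by
  simp only [edgeExpr, eval_input, eval_add, eval_mul, he, hf, eval_verticesExpr]
  refine (getD_table_of_eq (P := I.header) (by simp only [code, List.append_assoc]; rfl) rfl
    I.length_edgeTable v u.2).trans ?_
  simpa using table_getD' (f := fun u => [bit (u ∈ I.arena.edge v)]) (L := 1) (fun _ => rfl) u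
    one_pos

theorem eval_labelExpr {e : Expr} {s : Fin I.numStates} (he : e.eval I.code ρ = s) :
    (labelExpr e).eval I.code ρ = (I.arena.transducer.label s).code := by
  simp only [labelExpr, eval_input, eval_add, he, eval_labelOffset]
  have := getD_table_of_eq (A := I.code) (k := 7 + I.numVertices * I.numVertices)
    (f := fun s => [(I.arena.transducer.label s).code]) (P := I.header ++ _)
    (by simp only [code, List.append_assoc]; rfl)
    (by rw [List.length_append, table_length I.length_edgeTable]; rfl) (fun _ => rfl) s one_pos
  rw [Nat.mul_one, Nat.add_zero] at this
  exact this

theorem eval_stepExpr {e f g t h : Expr} {s : Fin I.numStates} {v : Fin I.numVertices}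
    (i : Player) (tie : Bool) {b : Fin (I.totalBudget + 1)} (he : e.eval I.code ρ = s)
    (hf : f.eval I.code ρ = v) (hg : g.eval I.code ρ = i.code) (ht : t.eval I.code ρ = tie.toNat)
    (hh : h.eval I.code ρ = b) :
    (stepExpr e f g t h).eval I.code ρ = I.arena.transducer.step s (v, i, tie, b) := by
  have hb := b.2
  have hv := v.2
  have hi : 2 * i.code + tie.toNat < 4 := by cases i <;> cases tie <;> simp [Player.code]
  simp only [stepExpr, eval_input, eval_add, eval_mul, he, hf, hg, ht, hh, eval_verticesExpr,
    eval_budgetExpr, eval_stepOffset, eval_ofNat]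
  refine (getD_table_of_eq (P := I.header ++ _ ++ _)
    (by simp only [code, List.append_assoc]; rfl)
    (by rw [List.length_append, List.length_append, table_length I.length_edgeTable,
      table_length (L := 1) (fun _ => rfl), mul_one]; rfl) I.length_stepTable s
    (by nlinarith)).trans ?_
  refine (table_getD' (f := fun v => table fun b =>
    [(I.arena.transducer.step s (v, .one, false, b) : ℕ),
      (I.arena.transducer.step s (v, .one, true, b) : ℕ),
      (I.arena.transducer.step s (v, .two, false, b) : ℕ),
      (I.arena.transducer.step s (v, .two, true, b) : ℕ)]) (fun _ => table_length fun _ => rfl) v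
    (by omega)).trans ?_
  refine (table_getD' (f := fun b =>
    [(I.arena.transducer.step s (v, .one, false, b) : ℕ),
      (I.arena.transducer.step s (v, .one, true, b) : ℕ),
      (I.arena.transducer.step s (v, .two, false, b) : ℕ),
      (I.arena.transducer.step s (v, .two, true, b) : ℕ)]) (L := 4) (fun _ => rfl) b hi).trans ?_
  cases i <;> cases tie <;> rfl

theorem eval_colourExpr {e : Expr} {v : Fin I.numVertices} (he : e.eval I.code ρ = v) :
    (colourExpr e).eval I.code ρ = I.colour v := by
  simp only [colourExpr, eval_input, eval_add, he, eval_colourOffset]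
  have := getD_table_of_eq (A := I.code) (f := fun v => [(I.colour v : ℕ)])
    (k := 7 + I.numVertices * I.numVertices +
      I.numStates + I.numStates * (I.numVertices * ((I.totalBudget + 1) * 4)))
    (P := I.header ++ _ ++ _ ++ _)
    (by simp only [code, List.append_assoc]; rfl)
    (by rw [List.length_append, List.length_append, List.length_append,
      table_length I.length_edgeTable, table_length (L := 1) (fun _ => rfl), mul_one,
      table_length I.length_stepTable]; rfl) (fun _ => rfl) v one_pos
  rw [Nat.mul_one, Nat.add_zero] at this
  exact this

theorem eval_dataEmit : dataEmit.eval I.code ρ = α.code I.data := by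
  rw [dataEmit, eval_rest (k := 7 + I.numVertices * I.numVertices + I.numStates +
    I.numStates * (I.numVertices * ((I.totalBudget + 1) * 4)) + I.numVertices) (fun ρ => rfl)]
  refine List.drop_left' ?_
  simp only [List.length_append]
  rw [table_length I.length_edgeTable, table_length (L := 1) (fun _ => rfl),
    table_length I.length_stepTable, table_length (L := 1) (fun _ => rfl)]
  simp

end

/-- The number of the vertex of the turn-based game that is coded by a tuple. -/
def packExpr (v B s x y w : Expr) : Expr :=
  w + (actionsExpr + 1) * y + (budgetExpr + 1 + 1) * (actionsExpr + 1) * x +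
    (budgetExpr + 1 + 1) * ((budgetExpr + 1 + 1) * (actionsExpr + 1)) * s +
    statesExpr * ((budgetExpr + 1 + 1) * ((budgetExpr + 1 + 1) * (actionsExpr + 1))) * B +
    (budgetExpr + 1) *
      (statesExpr * ((budgetExpr + 1 + 1) * ((budgetExpr + 1 + 1) * (actionsExpr + 1)))) * v

/-- The case distinction whether the variables `3` and `4` code bids. -/
def ifInter (e f : Expr) : Expr :=
  ifLt (.var 3) (budgetExpr + 1) (ifLt (.var 4) (budgetExpr + 1) e f) f

/-- The winner of the bidding that is coded by the variables `3` and `4`. -/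
def winnerExpr : Expr := ifLt (.var 4) (.var 3) 0 (ifLt (.var 3) (.var 4) 1 (labelExpr (.var 2)))

/-- The budget of a player. -/
def playerBudgetExpr : Player → Expr
  | .one => .var 1
  | .two => budgetExpr - .var 1

/-- Whether the action that is coded by the variable `6` is allowed for Player `i` in the vertex
that is coded by the variables `0` to `5`. -/
def allowedExpr (i : Player) : Expr :=
  ifInter
    (ifEq winnerExpr (.const i.code)
      (ifLt (.var 6) (budgetExpr + 1) 0 (edgeExpr (.var 0) (.var 6 - (budgetExpr + 1)))) 1)
    (ifLt (playerBudgetExpr i) (.var 6) 0 1)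

/-- The successor of an intermediate vertex if the winner of the bidding chooses the action that is
coded by `e`. The budget of Player 1 is capped at the total budget as in `BiddingArena.outcome`. -/
def moveExpr (e : Expr) : Expr :=
  ifLt e (budgetExpr + 1)
    (packExpr (.var 0) (.var 1) (.var 2) (.var 3) (.var 4) actionsExpr)
    (ifEq winnerExpr 0
      (packExpr (e - (budgetExpr + 1)) (.var 1 - .var 3)
        (stepExpr (.var 2) (e - (budgetExpr + 1)) 0 (ifEq (.var 3) (.var 4) 1 0) (.var 3))
        (budgetExpr + 1) (budgetExpr + 1) actionsExpr)
      (packExpr (e - (budgetExpr + 1))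
        (ifLt (.var 1 + .var 4) budgetExpr (.var 1 + .var 4) budgetExpr)
        (stepExpr (.var 2) (e - (budgetExpr + 1)) 1 (ifEq (.var 3) (.var 4) 1 0) (.var 4))
        (budgetExpr + 1) (budgetExpr + 1) actionsExpr))

/-- The successor of the vertex that is coded by the variables `0` to `5` if Player 1 chooses the
action coded by the variable `6`, and Player 2 the one coded by the variable `7`. -/
def nextExpr : Expr :=
  ifLt (.var 5) actionsExpr
    (ifInter
      (ifEq winnerExpr 0 (moveExpr (.var 5)) (moveExpr (.var 7)))
      (ifLt (.var 5) (budgetExpr + 1)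
        (ifLt (.var 7) (budgetExpr + 1)
          (packExpr (.var 0) (.var 1) (.var 2) (.var 5) (.var 7) actionsExpr)
          (packExpr (.var 0) (.var 1) (.var 2) (budgetExpr + 1) (budgetExpr + 1) actionsExpr))
        (packExpr (.var 0) (.var 1) (.var 2) (budgetExpr + 1) (budgetExpr + 1) actionsExpr)))
    (ifInter
      (packExpr (.var 0) (.var 1) (.var 2) (.var 3) (.var 4) (.var 6))
      (packExpr (.var 0) (.var 1) (.var 2) (budgetExpr + 1) (budgetExpr + 1) (.var 6)))

/-- Execute a program for all vertices of the turn-based game. -/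
def vertexLoop (P : Emit) : Emit :=
  loop 0 verticesExpr <| loop 1 (budgetExpr + 1) <| loop 2 statesExpr <|
    loop 3 (budgetExpr + 1 + 1) <| loop 4 (budgetExpr + 1 + 1) <| loop 5 (actionsExpr + 1) P

/-- The program that computes the code of the turn-based game of a bidding game. -/
def toTBEmit : Emit :=
  emit actionsExpr ++
    emit (verticesExpr * ((budgetExpr + 1) * (statesExpr * ((budgetExpr + 1 + 1) *
      ((budgetExpr + 1 + 1) * (actionsExpr + 1)))))) ++
    emit (packExpr (.input 3) (.input 4) (.input 5) (budgetExpr + 1) (budgetExpr + 1)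
      actionsExpr) ++
  vertexLoop (loop 6 actionsExpr (emit (allowedExpr .one) ++ emit (allowedExpr .two))) ++
  vertexLoop (loop 6 actionsExpr (loop 7 actionsExpr (emit nextExpr))) ++
  vertexLoop (emit (colourExpr (.var 0))) ++
  dataEmit

variable {α : QualitativeObjective} (I : BidInstance α) {ρ : ℕ → ℕ}

theorem eval_packExpr {e₀ e₁ e₂ e₃ e₄ e₅ : Expr} {v : Fin I.numVertices}
    {B : Fin (I.totalBudget + 1)} {s : Fin I.numStates} {x y : Fin (I.totalBudget + 1 + 1)}
    {w : Fin (I.totalBudget + 1 + I.numVertices + 1)}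
    (h₀ : e₀.eval I.code ρ = v) (h₁ : e₁.eval I.code ρ = B) (h₂ : e₂.eval I.code ρ = s)
    (h₃ : e₃.eval I.code ρ = x) (h₄ : e₄.eval I.code ρ = y) (h₅ : e₅.eval I.code ρ = w) :
    (packExpr e₀ e₁ e₂ e₃ e₄ e₅).eval I.code ρ = packVertex v B s x y w := by
  simp only [packExpr, eval_add, eval_mul, h₀, h₁, h₂, h₃, h₄, h₅]
  rfl

/-- The variables `0` to `5` code the vertex `packVertex v B s x y w`. -/
structure Codes (ρ : ℕ → ℕ) (v : Fin I.numVertices)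
    (B : Fin (I.totalBudget + 1)) (s : Fin I.numStates) (x y : Fin (I.totalBudget + 1 + 1))
    (w : Fin (I.totalBudget + 1 + I.numVertices + 1)) : Prop where
  h0 : ρ 0 = v
  h1 : ρ 1 = B
  h2 : ρ 2 = s
  h3 : ρ 3 = x
  h4 : ρ 4 = y
  h5 : ρ 5 = w

variable {v : Fin I.numVertices}
    {B : Fin (I.totalBudget + 1)} {s : Fin I.numStates} {x y : Fin (I.totalBudget + 1 + 1)}
    {w : Fin (I.totalBudget + 1 + I.numVertices + 1)}

variable {I}

theorem Codes.eval_ifInter (h : I.Codes ρ v B s x y w) (e f : Expr) :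
    (ifInter e f).eval I.code ρ =
      if (x : ℕ) < I.totalBudget + 1 ∧ (y : ℕ) < I.totalBudget + 1 then e.eval I.code ρ
      else f.eval I.code ρ := by
  simp only [ifInter, eval_ifLt, eval_var, eval_add, eval_budgetExpr, eval_ofNat, h.h3, h.h4]
  split_ifs <;> first | rfl | omega

theorem Codes.eval_winnerExpr (h : I.Codes ρ v B s x y w) (hx : (x : ℕ) < I.totalBudget + 1)
    (hy : (y : ℕ) < I.totalBudget + 1) :
    winnerExpr.eval I.code ρ = (I.arena.winner ⟨v, B, s⟩ ⟨x, hx⟩ ⟨y, hy⟩).code := by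
  simp only [winnerExpr, eval_ifLt, eval_var, eval_ofNat, h.h3, h.h4, BiddingArena.winner,
    Fin.mk_lt_mk, I.eval_labelExpr (e := .var 2) (s := s) h.h2]
  split_ifs <;> rfl

theorem Codes.eval_allowedExpr (h : I.Codes ρ v B s x y w)
    {a : Fin (I.totalBudget + 1 + I.numVertices)} (ha : ρ 6 = a) (i : Player) :
    (allowedExpr i).eval I.code ρ =
      bit (a ∈ I.toTB.arena.allowed (packVertex v B s x y w) i) := by
  classical
  have hmem : a ∈ I.toTB.arena.allowed (packVertex v B s x y w) i ↔
      decodeAction a ∈ I.arena.concurrent.allowed (decodePosition ⟨v, B, s⟩ x y) i := by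
    refine Iff.trans ?_ (iff_of_eq (congrArg (fun p : Position _ _ _ × _ =>
      decodeAction a ∈ I.arena.concurrent.allowed p.1 i)
      (decodeVertex_packVertex v B s x y w)))
    exact Iff.rfl
  rw [hmem, allowedExpr, h.eval_ifInter]
  unfold decodePosition
  split_ifs with hxy
  · simp only [eval_ifEq, h.eval_winnerExpr hxy.1 hxy.2, eval_ifLt, eval_var, ha, eval_add,
      eval_budgetExpr, eval_ofNat]
    have hm : decodeAction a ∈ I.arena.concurrent.allowed
        (.inter ⟨v, B, s⟩ ⟨x, hxy.1⟩ ⟨y, hxy.2⟩) i ↔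
        (i = I.arena.winner ⟨v, B, s⟩ ⟨x, hxy.1⟩ ⟨y, hxy.2⟩ →
          ∃ u ∈ I.arena.edge v, decodeAction a = .move u) := Iff.rfl
    rw [hm]
    split_ifs with hi hlt
    · have := Player.code_injective hi
      simp [bit_eq_ite, this, decodeAction, hlt]
    · have := Player.code_injective hi
      rw [I.eval_edgeExpr (e := .var 0) (v := v) (u := ⟨a - (I.totalBudget + 1), by omega⟩) h.h0 (by
        simp [ha, eval_budgetExpr])]
      simp [decodeAction, hlt, this]
    · have : i ≠ I.arena.winner ⟨v, B, s⟩ ⟨x, hxy.1⟩ ⟨y, hxy.2⟩ := fun h' => hi (by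
        rw [h']; rfl)
      rw [bit_eq_ite]
      simp [this]
  · have hm : decodeAction a ∈ I.arena.concurrent.allowed (.config ⟨v, B, s⟩) i ↔
        ∃ b : Fin (I.totalBudget + 1), (b : ℕ) ≤ Config.budget ⟨v, B, s⟩ i ∧
          decodeAction a = .bid b := Iff.rfl
    have hB : (playerBudgetExpr i).eval I.code ρ =
        Config.budget (⟨v, B, s⟩ : Config (Fin I.numVertices) (Fin I.numStates) I.totalBudget)
          i := by
      cases i
      · exact h.h1
      · simp [playerBudgetExpr, h.h1, Config.budget, eval_budgetExpr]
    have hBN : Config.budget (⟨v, B, s⟩ : Config (Fin I.numVertices) (Fin I.numStates)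
        I.totalBudget) i ≤ I.totalBudget := by
      cases i
      · exact Nat.le_of_lt_succ B.2
      · exact Nat.sub_le _ _
    have hiff : (∃ b : Fin (I.totalBudget + 1), (b : ℕ) ≤ Config.budget ⟨v, B, s⟩ i ∧
        decodeAction a = .bid b) ↔ ¬ Config.budget (⟨v, B, s⟩ : Config (Fin I.numVertices)
          (Fin I.numStates) I.totalBudget) i < a := by
      unfold decodeAction
      split_ifs with hlt
      · simp
      · simp
        omega
    rw [hm, bit_eq_ite, eval_ifLt, hB, eval_var, ha]
    simp only [hiff, ite_not]
    rfl

theorem toTB_next (v : Fin I.numVertices) (B : Fin (I.totalBudget + 1)) (s : Fin I.numStates)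
    (x y : Fin (I.totalBudget + 1 + 1)) (w : Fin (I.totalBudget + 1 + I.numVertices + 1))
    (a b : Fin (I.totalBudget + 1 + I.numVertices)) :
    I.toTB.arena.next (packVertex v B s x y w) a b =
      match decodeOption w with
      | none => encodeVertex (decodePosition ⟨v, B, s⟩ x y, some (decodeAction a))
      | some a' => encodeVertex
          (I.arena.concurrent.next (decodePosition ⟨v, B, s⟩ x y) a' (decodeAction b), none) := by
  simp only [toTB, ConcurrentArena.sequential, decodeVertex_packVertex]
  cases decodeOption w <;> rfl

theorem Codes.eval_moveExpr (h : I.Codes ρ v B s x y w) (hx : (x : ℕ) < I.totalBudget + 1)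
    (hy : (y : ℕ) < I.totalBudget + 1) {e : Expr} {a : Fin (I.totalBudget + 1 + I.numVertices)}
    (he : e.eval I.code ρ = a) :
    (moveExpr e).eval I.code ρ = encodeVertex ((match decodeAction a with
      | .move u => .config (I.arena.outcome ⟨v, B, s⟩ ⟨x, hx⟩ ⟨y, hy⟩ u)
      | .bid _ => .inter ⟨v, B, s⟩ ⟨x, hx⟩ ⟨y, hy⟩), none) := by
  have htie : (ifEq (.var 3) (.var 4) 1 0 : Expr).eval I.code ρ =
      (decide ((⟨x, hx⟩ : Fin (I.totalBudget + 1)) = ⟨y, hy⟩)).toNat := by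
    simp only [eval_ifEq, eval_var, h.h3, h.h4, eval_ofNat, Fin.mk.injEq]
    split_ifs with hxy <;> simp [hxy]
  have hlast : (budgetExpr + 1 : Expr).eval I.code ρ = Fin.last (I.totalBudget + 1) := rfl
  have hnone : actionsExpr.eval I.code ρ = Fin.last (I.totalBudget + 1 + I.numVertices) := rfl
  rw [moveExpr, eval_ifLt, he, hlast, Fin.val_last]
  by_cases ha : (a : ℕ) < I.totalBudget + 1
  · simp only [if_pos ha, decodeAction, dif_pos ha]
    exact I.eval_packExpr h.h0 h.h1 h.h2 h.h3 h.h4 hnone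
  · have hu : (e - (budgetExpr + 1)).eval I.code ρ =
        (⟨a - (I.totalBudget + 1), by omega⟩ : Fin I.numVertices) := by
      simp [he, eval_budgetExpr]
    simp only [if_neg ha, decodeAction, dif_neg ha]
    rw [eval_ifEq, h.eval_winnerExpr hx hy, BiddingArena.outcome]
    cases hw : I.arena.winner ⟨v, B, s⟩ ⟨x, hx⟩ ⟨y, hy⟩ with
    | one =>
      rw [if_pos (show Player.code .one = (0 : Expr).eval I.code ρ from rfl)]
      refine I.eval_packExpr hu ?_ (I.eval_stepExpr .one _ h.h2 hu rfl htie h.h3) hlast hlast hnone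
      simp [h.h1, h.h3]
    | two =>
      rw [if_neg (by simp [Player.code])]
      refine I.eval_packExpr hu ?_ (I.eval_stepExpr .two _ h.h2 hu rfl htie h.h4) hlast hlast hnone
      simp only [eval_ifLt, eval_add, eval_var, h.h1, h.h4, eval_budgetExpr]
      split_ifs <;> omega

theorem Codes.eval_nextExpr (h : I.Codes ρ v B s x y w)
    {a b : Fin (I.totalBudget + 1 + I.numVertices)} (ha : ρ 6 = a) (hb : ρ 7 = b) :
    nextExpr.eval I.code ρ = I.toTB.arena.next (packVertex v B s x y w) a b := by
  have hlast : (budgetExpr + 1 : Expr).eval I.code ρ = Fin.last (I.totalBudget + 1) := rfl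
  have hnone : actionsExpr.eval I.code ρ = Fin.last (I.totalBudget + 1 + I.numVertices) := rfl
  rw [toTB_next, nextExpr, eval_ifLt, eval_var, h.h5, hnone, Fin.val_last, h.eval_ifInter,
    h.eval_ifInter]
  by_cases hw : (w : ℕ) < I.totalBudget + 1 + I.numVertices
  · simp only [if_pos hw, decodeOption, dif_pos hw]
    by_cases hxy : (x : ℕ) < I.totalBudget + 1 ∧ (y : ℕ) < I.totalBudget + 1
    · simp only [if_pos hxy, decodePosition, dif_pos hxy]
      rw [eval_ifEq, h.eval_winnerExpr hxy.1 hxy.2, BiddingArena.next_inter]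
      cases I.arena.winner ⟨v, B, s⟩ ⟨x, hxy.1⟩ ⟨y, hxy.2⟩ with
      | one =>
        rw [if_pos (show Player.code .one = (0 : Expr).eval I.code ρ from rfl)]
        refine (h.eval_moveExpr hxy.1 hxy.2 (e := .var 5) (a := ⟨w, hw⟩) h.h5).trans ?_
        cases decodeAction (⟨w, hw⟩ : Fin (I.totalBudget + 1 + I.numVertices)) <;> rfl
      | two =>
        rw [if_neg (by simp [Player.code])]
        refine (h.eval_moveExpr hxy.1 hxy.2 (e := .var 7) hb).trans ?_
        cases decodeAction b <;> rfl
    · simp only [if_neg hxy, decodePosition, dif_neg hxy, eval_ifLt, hlast, eval_var, h.h5, hb,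
        Fin.val_last, decodeAction]
      by_cases hwb : (w : ℕ) < I.totalBudget + 1
      · simp only [if_pos hwb, dif_pos hwb]
        by_cases hbb : (b : ℕ) < I.totalBudget + 1
        · simp only [if_pos hbb, dif_pos hbb]
          exact I.eval_packExpr (x := Fin.castSucc ⟨w, hwb⟩) (y := Fin.castSucc ⟨b, hbb⟩)
            h.h0 h.h1 h.h2 h.h5 hb hnone
        · simp only [if_neg hbb, dif_neg hbb]
          exact I.eval_packExpr h.h0 h.h1 h.h2 hlast hlast hnone
      · simp only [if_neg hwb, dif_neg hwb]
        exact I.eval_packExpr h.h0 h.h1 h.h2 hlast hlast hnone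
  · have ha' : (Expr.var 6).eval I.code ρ = encodeOption (some (decodeAction a)) := by
      simp only [encodeOption, encodeAction_decodeAction]
      exact ha
    simp only [if_neg hw, decodeOption, dif_neg hw]
    by_cases hxy : (x : ℕ) < I.totalBudget + 1 ∧ (y : ℕ) < I.totalBudget + 1
    · simp only [if_pos hxy, decodePosition, dif_pos hxy]
      exact I.eval_packExpr h.h0 h.h1 h.h2 h.h3 h.h4 ha'
    · simp only [if_neg hxy, decodePosition, dif_neg hxy]
      exact I.eval_packExpr h.h0 h.h1 h.h2 hlast hlast ha'

variable (I)

theorem eval_vertexLoop {P : Emit}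
    {f : Fin (sequentialSize I.numVertices I.numStates I.totalBudget) → List ℕ}
    (h : ∀ (ρ : ℕ → ℕ) v B s x y w, I.Codes ρ v B s x y w →
      P.eval I.code ρ = f (packVertex v B s x y w)) :
    (vertexLoop P).eval I.code ρ = table f := by
  rw [table_sequential]
  refine (table_eq_flatMap fun v => table_eq_flatMap fun B => table_eq_flatMap fun s =>
    table_eq_flatMap fun x => table_eq_flatMap fun y => table_eq_flatMap fun w => ?_).symm
  exact (h _ v B s x y w ⟨by simp, by simp, by simp, by simp, by simp, by simp⟩).symm

theorem eval_toTBEmit : toTBEmit.eval I.code 0 = I.toTB.code := by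
  have h1 := I.eval_vertexLoop (ρ := 0)
    (P := loop 6 actionsExpr (emit (allowedExpr .one) ++ emit (allowedExpr .two)))
    (f := fun k => table fun a => [bit (a ∈ I.toTB.arena.allowed k .one),
      bit (a ∈ I.toTB.arena.allowed k .two)]) (fun ρ v B s x y w h =>
        (table_eq_flatMap fun a => by
          have h' : I.Codes (Function.update ρ 6 a) v B s x y w :=
            ⟨h.h0, h.h1, h.h2, h.h3, h.h4, h.h5⟩
          rw [eval_append, eval_emit, eval_emit, h'.eval_allowedExpr (a := a) (by simp),
            h'.eval_allowedExpr (a := a) (by simp)]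
          rfl).symm)
  have h2 := I.eval_vertexLoop (ρ := 0)
    (P := loop 6 actionsExpr (loop 7 actionsExpr (emit nextExpr)))
    (f := fun k => table fun a => table fun b => [(I.toTB.arena.next k a b : ℕ)])
    (fun ρ v B s x y w h =>
      (table_eq_flatMap fun a => table_eq_flatMap fun b => by
        have h' : I.Codes (Function.update (Function.update ρ 6 a) 7 b) v B s x y w :=
          ⟨h.h0, h.h1, h.h2, h.h3, h.h4, h.h5⟩
        rw [eval_emit, h'.eval_nextExpr (a := a) (b := b) (by simp) (by simp)]).symm)
  have h3 := I.eval_vertexLoop (ρ := 0) (P := emit (colourExpr (.var 0)))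
    (f := fun k => [(I.toTB.colour k : ℕ)]) (fun ρ v B s x y w h => by
      rw [eval_emit, I.eval_colourExpr (e := .var 0) (v := v) h.h0]
      have : I.toTB.colour (packVertex v B s x y w) = I.colour v := by
        simp only [toTB, decodeVertex_packVertex, token_decodePosition]
      rw [this])
  have h4 : (packExpr (.input 3) (.input 4) (.input 5) (budgetExpr + 1) (budgetExpr + 1)
      actionsExpr).eval I.code 0 = I.toTB.start :=
    I.eval_packExpr (v := I.start.vertex) (B := I.start.budgetOne) (s := I.start.state)
      (x := Fin.last _) (y := Fin.last _) (w := Fin.last _) rfl rfl rfl rfl rfl rfl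
  rw [toTBEmit]
  simp only [eval_append, h1, h2, h3, eval_dataEmit]
  simp only [eval_emit, h4]
  rfl

end BidInstance

theorem bidWin_reducible_tbWin (α : QualitativeObjective) :
    PolyTimeReducible (bidWin α) (tbWin α) :=
  ⟨BidInstance.toTB, BidInstance.toTBEmit.computableInPolyTime _ _ _ fun I => I.eval_toTBEmit,
    fun I => I.toTB_yes⟩

theorem bidWinUnaware_reducible_tbWin (α : QualitativeObjective) :
    PolyTimeReducible (bidWinUnaware α) (tbWin α) :=
  ⟨fun I => I.1.toTB, BidInstance.toTBEmit.computableInPolyTime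
    (fun I : {I : BidInstance α // I.arena.UnawareOfTies} => I.1.code) _ _
    fun I => I.1.eval_toTBEmit, fun I => I.1.toTB_yes⟩

end BiddingGames

theorem mainTheorem6 (α : BiddingGames.QualitativeObjective) :
    BiddingGames.SameComplexity (BiddingGames.tbWin α) (BiddingGames.bidWin α) ∧
      BiddingGames.SameComplexity (BiddingGames.tbWin α) (BiddingGames.bidWinUnaware α) :=
  ⟨⟨BiddingGames.tbWin_reducible_bidWin α, BiddingGames.bidWin_reducible_tbWin α⟩,
    BiddingGames.tbWin_reducible_bidWinUnaware α, BiddingGames.bidWinUnaware_reducible_tbWin α⟩
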